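/- **Setting.** Let $\mathbb Y$ be the set of all Young diagrams (including $\varnothing$), $\mathbb Y_n$ the set of diagrams with $n$ boxes, and write $\mu\nearrow\lambda$ if $\lambda$ is obtained from $\mu$ by adding one box. Let $\dim(\mu,\lambda)$ be the number of chains $\mu\nearrow\dots\nearrow\lambda$ (so it is $0$ unless $\mu\subseteq\lambda$), and $\dim\lambda=\dim(\varnothing,\lambda)$. For $z\in\mathbb C$ and $\mu\subseteq\lambda$ put $(z)_{\lambda/\mu}=\prod_{(i,j)\in\lambda/\mu}(z+j-i)$, the product over the boxes in row $i$ and column $j$ of $\lambda/\mu$. Let $K$ be a field with a fixed embedding into $\mathbb C$ (for instance $K=\mathbb R$ or $K=\mathbb C$), and let $\Lambda=K[p_1,p_2,\dots]$ be the algebra of symmetric functions over $K$, freely generated by the Newton power sums $p_k$. For $f\in\Lambda$ and $\lambda\in\mathbb Y$ the value $f(\lambda)$ is given by the algebra morphism from $\Lambda$ to the algebra of $K$-valued functions on $\mathbb Y$ such that $$p_k(\lambda)=\sum_{i=1}^d a_i^k+(-1)^{k-1}\sum_{i=1}^d b_i^k ,$$ where $d$ is the number of diagonal boxes of $\lambda$,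 $a_i$ is $\tfrac12$ plus the number of boxes in the $i$th row to the right of the diagonal, and $b_i$ is $\tfrac12$ plus the number of boxes in the $i$th column below the diagonal. Let $f_n$ be the restriction of $f(\,\cdot\,)$ to $\mathbb Y_n$. The morphism is injective, and for every $\mu\in\mathbb Y$ there is a unique $FS_\mu\in\Lambda$ (the Frobenius–Schur function) such that $$FS_\mu(\lambda)=n(n-1)\cdots(n-m+1)\,\frac{\dim(\mu,\lambda)}{\dim\lambda}\quad\text{for all }\lambda\in\mathbb Y,\qquad n=|\lambda|,\ m=|\mu|;$$ the elements $FS_\mu$, $\mu\in\mathbb Y$, form a basis of $\Lambda$ over $K$. For $n\ge 0$, the down operator takes functions $f$ on $\mathbb Y_n$ to functions on $\mathbb Y_{n+1}$: $$(D_{n+1,n}f)(\nu)=\sum_{\lambda\nearrow\nu}\frac{\dim\lambda}{\dim\nu}\,f(\lambda),\qquad \nu\in\mathbb Y_{n+1}.$$ For $z,z'\in\mathbb C$ with $zz'\notin\{0,-1,-2,\dots\}$, the up operator takes complex-valued functions $g$ on $\mathbb Y_{n+1}$ to functions on $\mathbb Y_n$: $$(U_{n,n+1}g)(\lambda)=\sum_{\nu:\,\lambda\nearrow\nu}\frac{(z)_{\nu/\lambda}(z')_{\nu/\lambda}}{zz'+n}\,\frac{\dim\nu}{(n+1)\dim\lambda}\,g(\nu),\qquad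 \lambda\in\mathbb Y_n.$$ **Theorem 4.1.** (1) There exists a unique $K$-linear operator $\widetilde D:\Lambda\to\Lambda$ such that $$D_{n+1,n}f_n=\frac1{n+1}(\widetilde Df)_{n+1}\qquad\text{for all } n=0,1,2,\dots\text{ and all }f\in\Lambda.$$ In the basis $\{FS_\mu\}$ it is given by $$\widetilde D\,FS_\mu=(p_1-|\mu|)\,FS_\mu,\qquad \mu\in\mathbb Y.$$ (2) Let $z,z'\in\mathbb C$ be such that $zz'\notin\{0,-1,-2,\dots\}$ and both $z+z'$ and $zz'$ lie in $K$. There exists a unique $K$-linear operator $\widetilde U:\Lambda\to\Lambda$ (depending on $z,z'$) such that $$U_{n,n+1}f_{n+1}=\frac1{zz'+n}(\widetilde Uf)_n\qquad\text{for all } n=0,1,2,\dots\text{ and all }f\in\Lambda.$$ In the basis $\{FS_\mu\}$ it is given by $$\widetilde U\,FS_\mu=\sum_{\mu_\bullet\nearrow\mu}(z)_{\mu/\mu_\bullet}(z')_{\mu/\mu_\bullet}\,FS_{\mu_\bullet}+(p_1+zz'+|\mu|)\,FS_\mu,\qquad \mu\in\mathbb Y.$$ -/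

import Mathlib

namespace YoungUpDown

/-! ### Young diagrams -/

/-- `Up μ ν` is the relation `μ ↗ ν`: the diagram `ν` is obtained from `μ` by adding one box. -/
def Up (μ ν : YoungDiagram) : Prop :=
  μ ≤ ν ∧ ν.card = μ.card + 1

/-- The set `𝕐_n` of Young diagrams with `n` boxes. -/
abbrev Level (n : ℕ) : Type := {ν : YoungDiagram // ν.card = n}

theorem fst_lt_card {ν : YoungDiagram} {c : ℕ × ℕ} (hc : c ∈ ν.cells) : c.1 < ν.card := by
  have h : (Finset.range (c.1 + 1)).image (fun i => (i, c.2)) ⊆ ν.cells := by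
    intro x hx
    obtain ⟨i, hi, rfl⟩ := Finset.mem_image.1 hx
    have hi' : i ≤ c.1 := Nat.lt_succ_iff.1 (Finset.mem_range.1 hi)
    exact ν.isLowerSet (show ((i, c.2) : ℕ × ℕ) ≤ c from ⟨hi', le_refl _⟩) hc
  have h2 := Finset.card_le_card h
  rw [Finset.card_image_of_injective _ (fun a b hab => (Prod.mk.inj hab).1),
    Finset.card_range] at h2
  exact h2

theorem snd_lt_card {ν : YoungDiagram} {c : ℕ × ℕ} (hc : c ∈ ν.cells) : c.2 < ν.card := by
  have h : (Finset.range (c.2 + 1)).image (fun j => (c.1, j)) ⊆ ν.cells := by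
    intro x hx
    obtain ⟨j, hj, rfl⟩ := Finset.mem_image.1 hx
    have hj' : j ≤ c.2 := Nat.lt_succ_iff.1 (Finset.mem_range.1 hj)
    exact ν.isLowerSet (show ((c.1, j) : ℕ × ℕ) ≤ c from ⟨le_refl _, hj'⟩) hc
  have h2 := Finset.card_le_card h
  rw [Finset.card_image_of_injective _ (fun a b hab => (Prod.mk.inj hab).2),
    Finset.card_range] at h2
  exact h2

instance finite_level (n : ℕ) : Finite (Level n) := by
  let g : Level n → ((Finset.range n ×ˢ Finset.range n).powerset : Finset (Finset (ℕ × ℕ))) :=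
    fun ν => ⟨ν.1.cells, by
      refine Finset.mem_powerset.2 (fun c hc => Finset.mem_product.2 ⟨?_, ?_⟩)
      · exact Finset.mem_range.2 (lt_of_lt_of_eq (fst_lt_card hc) ν.2)
      · exact Finset.mem_range.2 (lt_of_lt_of_eq (snd_lt_card hc) ν.2)⟩
  refine Finite.of_injective g (fun a b hab => ?_)
  exact Subtype.ext (YoungDiagram.ext (Subtype.ext_iff.1 hab))

noncomputable instance fintypeLevel (n : ℕ) : Fintype (Level n) := Fintype.ofFinite _

theorem finite_setOf_up (μ : YoungDiagram) : {κ : YoungDiagram | Up κ μ}.Finite := by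
  refine Set.Finite.subset (Set.finite_range (fun κ : Level (μ.card - 1) => κ.1)) ?_
  intro κ hκ
  have h := hκ.2
  exact ⟨⟨κ, by omega⟩, rfl⟩

/-- The finite set of all diagrams `μ_•` with `μ_• ↗ μ`. -/
noncomputable def lower (μ : YoungDiagram) : Finset YoungDiagram :=
  (finite_setOf_up μ).toFinset

/-- `dim(μ, ν)`: the number of chains `μ = c₀ ↗ c₁ ↗ ⋯ ↗ c_k = ν`. A chain has
`k = |ν| - |μ|` steps; there is none if `|ν| < |μ|`. -/
noncomputable def dimSkew (μ ν : YoungDiagram) : ℕ :=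
  Nat.card {c : Fin (ν.card - μ.card + 1) → YoungDiagram //
    c 0 = μ ∧ c (Fin.last _) = ν ∧ ∀ i : Fin (ν.card - μ.card), Up (c i.castSucc) (c i.succ)}

/-- `dim ν = dim(∅, ν)`, the number of standard Young tableaux of shape `ν`. -/
noncomputable def dim (ν : YoungDiagram) : ℕ := dimSkew ⊥ ν

/-- `(z)_{ν/μ}`, the product of `z + j - i` over the boxes `(i, j)` of `ν / μ`. The content `j - i`
does not depend on whether rows and columns are numbered from `0` or from `1`. -/
noncomputable def poch (z : ℂ) (ν μ : YoungDiagram) : ℂ :=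
  ∏ c ∈ ν.cells \ μ.cells, (z + (c.2 : ℂ) - (c.1 : ℂ))

/-! ### Symmetric functions as functions on Young diagrams -/

/-- The number of diagonal boxes. -/
def diagLen (ν : YoungDiagram) : ℕ := (ν.cells.filter (fun c => c.1 = c.2)).card

/-- The modified Frobenius coordinate `a_{i+1}`, for `i < diagLen ν`: one half plus the number of
boxes to the right of the diagonal in the row with index `i` (rows are numbered from `0` here). -/
def frobA (𝕜 : Type*) [Field 𝕜] (ν : YoungDiagram) (i : ℕ) : 𝕜 :=
  (ν.rowLen i : 𝕜) - ((i : 𝕜) + 1) + 1 / 2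

/-- The modified Frobenius coordinate `b_{i+1}`, for `i < diagLen ν`: one half plus the number of
boxes below the diagonal in the column with index `i`. -/
def frobB (𝕜 : Type*) [Field 𝕜] (ν : YoungDiagram) (i : ℕ) : 𝕜 :=
  (ν.colLen i : 𝕜) - ((i : 𝕜) + 1) + 1 / 2

/-- The algebra `Λ` of symmetric functions over `𝕜`, as the commutative unital algebra freely
generated by the Newton power sums `p_k`, `k = 1, 2, …`. -/
abbrev Sym (𝕜 : Type*) [Field 𝕜] : Type _ := MvPolynomial ℕ+ 𝕜

/-- The Newton power sum `p_k`. -/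
noncomputable def psum (𝕜 : Type*) [Field 𝕜] (k : ℕ+) : Sym 𝕜 := MvPolynomial.X k

/-- The algebra morphism `Λ → Fun(𝕐)` that sends `p_k` to
`ν ↦ ∑ a_i ^ k + (-1) ^ (k - 1) ∑ b_i ^ k`. -/
noncomputable def toFun (𝕜 : Type*) [Field 𝕜] : Sym 𝕜 →ₐ[𝕜] (YoungDiagram → 𝕜) :=
  MvPolynomial.aeval (fun (k : ℕ+) (ν : YoungDiagram) =>
    ∑ i ∈ Finset.range (diagLen ν), frobA 𝕜 ν i ^ (k : ℕ) +
      (-1) ^ ((k : ℕ) - 1) * ∑ i ∈ Finset.range (diagLen ν), frobB 𝕜 ν i ^ (k : ℕ))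

/-- `f_n`, the restriction to `𝕐_n` of the function on `𝕐` given by `f ∈ Λ`. -/
noncomputable def restrict {𝕜 : Type*} [Field 𝕜] (n : ℕ) (f : Sym 𝕜) : Level n → 𝕜 :=
  fun ν => toFun 𝕜 f ν.1

/-- The function `ν ↦ n(n-1)⋯(n-m+1) dim(μ, ν) / dim ν` on Young diagrams, where `n = |ν|` and
`m = |μ|`. -/
noncomputable def fsFun (𝕜 : Type*) [Field 𝕜] (μ : YoungDiagram) : YoungDiagram → 𝕜 :=
  fun ν => (ν.card.descFactorial μ.card : 𝕜) * ((dimSkew μ ν : 𝕜) / (dim ν : 𝕜))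

/-- The Frobenius–Schur function `FS_μ`: the element of `Λ` that `Λ → Fun(𝕐)` sends to `fsFun 𝕜 μ`.
(That such an element exists and is unique is to be proved.) -/
noncomputable def FS (𝕜 : Type*) [Field 𝕜] (μ : YoungDiagram) : Sym 𝕜 :=
  Function.invFun (toFun 𝕜) (fsFun 𝕜 μ)

/-! ### Transition functions and the down and up operators -/

open Classical in
/-- The down transition function `p^↓(ν, κ)`. -/
noncomputable def pDown (𝕜 : Type*) [Field 𝕜] (ν κ : YoungDiagram) : 𝕜 :=
  if Up κ ν then (dim κ : 𝕜) / (dim ν : 𝕜) else 0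

open Classical in
/-- The up transition function `p^↑_{z,z'}(κ, ν)`. -/
noncomputable def pUp (z z' : ℂ) (κ ν : YoungDiagram) : ℂ :=
  if Up κ ν then
    (poch z ν κ * poch z' ν κ) / (z * z' + (κ.card : ℂ)) *
      ((dim ν : ℂ) / (((κ.card : ℂ) + 1) * (dim κ : ℂ)))
  else 0

/-- The down operator `D_{n+1,n}`. -/
noncomputable def downOp {𝕜 : Type*} [Field 𝕜] (n : ℕ) (f : Level n → 𝕜) : Level (n + 1) → 𝕜 :=
  fun ν => ∑ κ : Level n, pDown 𝕜 ν.1 κ.1 * f κ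

/-- The up operator `U_{n,n+1}` with parameters `z, z'`. -/
noncomputable def upOp (z z' : ℂ) (n : ℕ) (g : Level (n + 1) → ℂ) : Level n → ℂ :=
  fun κ => ∑ ν : Level (n + 1), pUp z z' κ.1 ν.1 * g ν

/-- The linear operator `D` on `Λ` implements the down operators:
`D_{n+1,n} f_n = (1 / (n + 1)) (D f)_{n+1}` for all `n` and `f`. -/
def ImplementsDown {𝕜 : Type*} [Field 𝕜] (D : Sym 𝕜 →ₗ[𝕜] Sym 𝕜) : Prop :=
  ∀ (n : ℕ) (f : Sym 𝕜),
    downOp n (restrict n f) = (1 / ((n : 𝕜) + 1)) • restrict (n + 1) (D f)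

/-- The linear operator `U` on `Λ` implements the up operators with parameters `z, z'`:
`U_{n,n+1} f_{n+1} = (1 / (z z' + n)) (U f)_n` for all `n` and `f`; here the `𝕜`-valued functions
`f_{n+1}` and `(U f)_n` are regarded as complex-valued. -/
def ImplementsUp {𝕜 : Type*} [Field 𝕜] [Algebra 𝕜 ℂ] (z z' : ℂ)
    (U : Sym 𝕜 →ₗ[𝕜] Sym 𝕜) : Prop :=
  ∀ (n : ℕ) (f : Sym 𝕜),
    upOp z z' n (fun ν => algebraMap 𝕜 ℂ (restrict (n + 1) f ν)) =
      (1 / (z * z' + (n : ℂ))) • (fun κ => algebraMap 𝕜 ℂ (restrict n (U f) κ))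

/-- The inclusion of `Λ` over `𝕜` into `Λ` over `ℂ`. -/
noncomputable def complexify {𝕜 : Type*} [Field 𝕜] [Algebra 𝕜 ℂ] : Sym 𝕜 →+* Sym ℂ :=
  MvPolynomial.map (algebraMap 𝕜 ℂ)

end YoungUpDown

namespace YoungUpDown

open Finset

/-! ### Rows, corners and adjacent diagrams -/

/-! The proof computes both operators on the functions `fsFun 𝕜 μ`, shows that these functions are a
basis of the image of `Λ`, and transports the result through the injection `toFun 𝕜`.

Write m = |μ|. The down formula is the branching rule dim(μ,ν) = ∑ dim(μ,κ) over κ ↗ ν, together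
with (n+1-m)·(n+1)(n)⋯(n-m+2) = (n+1)·n(n-1)⋯(n-m+1); since p_1(ν) = |ν|, the factor |ν| - m is the
value of p_1 - m (`downOp_fsFun`). For the up formula, multiplying by dim turns the operator into
Kerov's operator, which adds a box of content c with weight (z+c)(z'+c). Its commutator with box
removal is the scalar zz' + 2n on diagrams of size n (`sum_upper_sum_lower`), and induction on |ν| -
|μ| then gives its action on dim(μ,·) (`sum_upper_weight_dimSkew`, `upOp_fsFun`).

For the basis, `fsFun_mul_alt` writes `fsFun 𝕜 μ` on diagrams with at most N rows as a quotient of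
two alternants of falling factorials in the shifted row lengths; the denominator is a Vandermonde
determinant. On such diagrams each p_k is, up to a constant, a power sum of shifted row lengths
(`toFun_psum_eq_sum_beta`), and multiplying an alternant by a power sum gives a combination of
alternants. So symmetric functions of weight at most m land in the span of the `fsFun 𝕜 μ` with |μ|
≤ m. That map is injective (`toFun_complex_injective`), and there are at least as many monomials of
weight at most m as diagrams with at most m boxes, so it is onto (`map_toFun_restrictSupport`).
Linear independence is triangularity with respect to size.

Uniqueness of the operators follows from injectivity. The down relation says nothing about the value
at ∅; there one multiplies by p_1 and cancels it in the domain `Λ`. -/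

theorem rowLen_eq_of_forall_mem_iff {ν : YoungDiagram} {i n : ℕ}
    (h : ∀ j, (i, j) ∈ ν ↔ j < n) : ν.rowLen i = n := by
  have h1 := h n
  have h2 := h (ν.rowLen i)
  rw [YoungDiagram.mem_iff_lt_rowLen] at h1 h2
  omega

theorem ext_rowLen {κ ν : YoungDiagram} (h : ∀ i, κ.rowLen i = ν.rowLen i) : κ = ν := by
  refine YoungDiagram.ext (Finset.ext fun c => ?_)
  obtain ⟨i, j⟩ := c
  rw [YoungDiagram.mem_cells, YoungDiagram.mem_cells, YoungDiagram.mem_iff_lt_rowLen,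
    YoungDiagram.mem_iff_lt_rowLen, h]

theorem rowLen_eq_zero_of_le {ν : YoungDiagram} {M N : ℕ} (h : ν.rowLen M = 0) (hMN : M ≤ N) :
    ν.rowLen N = 0 :=
  Nat.le_zero.1 (h ▸ ν.rowLen_anti M N hMN)

theorem rowLen_eq_zero_of_card_le {ν : YoungDiagram} {N : ℕ} (h : ν.card ≤ N) :
    ν.rowLen N = 0 := by
  by_contra h0
  have : (N, 0) ∈ ν.cells := by
    rw [YoungDiagram.mem_cells, YoungDiagram.mem_iff_lt_rowLen]; omega
  have := fst_lt_card this
  simp only at this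
  omega

theorem sum_cells {M : Type*} [AddCommMonoid M] {ν : YoungDiagram} {N : ℕ}
    (hN : ν.rowLen N = 0) (F : ℕ × ℕ → M) :
    ∑ c ∈ ν.cells, F c = ∑ r ∈ range N, ∑ j ∈ range (ν.rowLen r), F (r, j) := by
  rw [Finset.sum_sigma']
  refine Finset.sum_nbij' (fun c => ⟨c.1, c.2⟩) (fun c => (c.1, c.2)) ?_ ?_ ?_ ?_ ?_
  · rintro ⟨i, j⟩ h
    rw [YoungDiagram.mem_cells, YoungDiagram.mem_iff_lt_rowLen] at h
    simp only [mem_sigma, mem_range]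
    refine ⟨?_, h⟩
    by_contra hi
    have := rowLen_eq_zero_of_le hN (not_lt.1 hi)
    omega
  · rintro ⟨i, j⟩ h
    simp only [mem_sigma, mem_range] at h
    rw [YoungDiagram.mem_cells, YoungDiagram.mem_iff_lt_rowLen]
    exact h.2
  all_goals simp

theorem card_eq_sum_rowLen {ν : YoungDiagram} {N : ℕ} (hN : ν.rowLen N = 0) :
    ν.card = ∑ r ∈ range N, ν.rowLen r := by
  have := sum_cells hN (fun _ => 1)
  simpa using this

theorem eq_of_le_of_card_eq {κ ν : YoungDiagram} (h : κ ≤ ν) (hc : κ.card = ν.card) : κ = ν :=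
  YoungDiagram.ext (Finset.eq_of_subset_of_card_le (YoungDiagram.cells_subset_iff.2 h) hc.ge)

@[simp] theorem mem_lower {κ ν : YoungDiagram} : κ ∈ lower ν ↔ Up κ ν := by
  simp [lower]

theorem finite_setOf_up_right (κ : YoungDiagram) : {ν : YoungDiagram | Up κ ν}.Finite := by
  refine Set.Finite.subset (Set.finite_range (fun ν : Level (κ.card + 1) => ν.1)) ?_
  intro ν hν
  exact ⟨⟨ν, hν.2⟩, rfl⟩

/-- The finite set of all diagrams obtained from `κ` by adding one box. -/
noncomputable def upper (κ : YoungDiagram) : Finset YoungDiagram :=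
  (finite_setOf_up_right κ).toFinset

@[simp] theorem mem_upper {κ ν : YoungDiagram} : ν ∈ upper κ ↔ Up κ ν := by
  simp [upper]

/-- Row `r` of `ν` ends in a box that can be removed. -/
def Removable (ν : YoungDiagram) (r : ℕ) : Prop := ν.rowLen (r + 1) < ν.rowLen r

/-- A box can be added at the end of row `r` of `ν`. -/
def Addable (ν : YoungDiagram) (r : ℕ) : Prop := ∀ s, s + 1 = r → ν.rowLen r < ν.rowLen s

open Classical in
/-- The diagram `ν` without the last box of row `r`, if that box can be removed. -/
noncomputable def removeBox (ν : YoungDiagram) (r : ℕ) : YoungDiagram :=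
  if h : Removable ν r then
    { cells := ν.cells.erase (r, ν.rowLen r - 1)
      isLowerSet := by
        rintro ⟨i, j⟩ ⟨i', j'⟩ ⟨hi, hj⟩ hc
        simp only at hi hj
        simp only [coe_erase, Set.mem_sdiff, mem_coe, YoungDiagram.mem_cells,
          Set.mem_singleton_iff, Prod.mk.injEq] at hc ⊢
        refine ⟨ν.up_left_mem hi hj hc.1, ?_⟩
        rintro ⟨rfl, rfl⟩
        have h1 := YoungDiagram.mem_iff_lt_rowLen.1 hc.1
        have h2 : i = i' := by
          by_contra hne
          have := ν.rowLen_anti (i' + 1) i (by omega)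
          unfold Removable at h
          omega
        subst h2
        exact hc.2 ⟨rfl, by omega⟩ }
  else ν

open Classical in
/-- The diagram `ν` with one more box in row `r`, if a box can be added there. -/
noncomputable def addBox (ν : YoungDiagram) (r : ℕ) : YoungDiagram :=
  if h : Addable ν r then
    { cells := insert (r, ν.rowLen r) ν.cells
      isLowerSet := by
        rintro ⟨i, j⟩ ⟨i', j'⟩ ⟨hi, hj⟩ hc
        simp only at hi hj
        simp only [coe_insert, Set.mem_insert_iff, mem_coe, YoungDiagram.mem_cells,
          Prod.mk.injEq] at hc ⊢
        rcases hc with ⟨rfl, rfl⟩ | hc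
        · by_cases hi' : i' = i
          · subst hi'
            by_cases hj' : j' = ν.rowLen i'
            · exact Or.inl ⟨rfl, hj'⟩
            · exact Or.inr (YoungDiagram.mem_iff_lt_rowLen.2 (by omega))
          · have h1 := h (i - 1) (by omega)
            have h2 := ν.rowLen_anti i' (i - 1) (by omega)
            exact Or.inr (YoungDiagram.mem_iff_lt_rowLen.2 (by omega))
        · exact Or.inr (ν.up_left_mem hi hj hc) }
  else ν

theorem cells_removeBox {ν : YoungDiagram} {r : ℕ} (h : Removable ν r) :
    (removeBox ν r).cells = ν.cells.erase (r, ν.rowLen r - 1) := by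
  rw [removeBox, dif_pos h]

theorem cells_addBox {ν : YoungDiagram} {r : ℕ} (h : Addable ν r) :
    (addBox ν r).cells = insert (r, ν.rowLen r) ν.cells := by
  rw [addBox, dif_pos h]

theorem mem_cells_of_removable {ν : YoungDiagram} {r : ℕ} (h : Removable ν r) :
    (r, ν.rowLen r - 1) ∈ ν.cells := by
  rw [YoungDiagram.mem_cells, YoungDiagram.mem_iff_lt_rowLen]
  unfold Removable at h
  omega

theorem notMem_cells_rowLen (ν : YoungDiagram) (r : ℕ) : (r, ν.rowLen r) ∉ ν.cells := by
  rw [YoungDiagram.mem_cells, YoungDiagram.mem_iff_lt_rowLen]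
  omega

theorem up_removeBox {ν : YoungDiagram} {r : ℕ} (h : Removable ν r) : Up (removeBox ν r) ν := by
  constructor
  · rw [← YoungDiagram.cells_subset_iff, cells_removeBox h]
    exact erase_subset _ _
  · change ν.cells.card = (removeBox ν r).cells.card + 1
    rw [cells_removeBox h, card_erase_add_one (mem_cells_of_removable h)]

theorem up_addBox {ν : YoungDiagram} {r : ℕ} (h : Addable ν r) : Up ν (addBox ν r) := by
  constructor
  · rw [← YoungDiagram.cells_subset_iff, cells_addBox h]
    exact subset_insert _ _
  · change (addBox ν r).cells.card = ν.cells.card + 1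
    rw [cells_addBox h, card_insert_of_notMem (notMem_cells_rowLen ν r)]

theorem rowLen_removeBox_self {ν : YoungDiagram} {r : ℕ} (h : Removable ν r) :
    (removeBox ν r).rowLen r = ν.rowLen r - 1 := by
  refine rowLen_eq_of_forall_mem_iff fun j => ?_
  rw [← YoungDiagram.mem_cells, cells_removeBox h, mem_erase, YoungDiagram.mem_cells,
    YoungDiagram.mem_iff_lt_rowLen]
  simp only [ne_eq, Prod.mk.injEq, true_and]
  omega

theorem rowLen_removeBox_of_ne {ν : YoungDiagram} {r s : ℕ} (hs : s ≠ r) :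
    (removeBox ν r).rowLen s = ν.rowLen s := by
  by_cases h : Removable ν r
  · refine rowLen_eq_of_forall_mem_iff fun j => ?_
    rw [← YoungDiagram.mem_cells, cells_removeBox h, mem_erase, YoungDiagram.mem_cells,
      YoungDiagram.mem_iff_lt_rowLen]
    simp [hs]
  · rw [removeBox, dif_neg h]

theorem exists_eq_insert_of_up {κ ν : YoungDiagram} (h : Up κ ν) :
    ∃ c, c ∉ κ.cells ∧ ν.cells = insert c κ.cells := by
  have hs := YoungDiagram.cells_subset_iff.2 h.1
  have hc : (ν.cells \ κ.cells).card = 1 := by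
    rw [card_sdiff_of_subset hs]
    have := h.2
    change ν.cells.card = κ.cells.card + 1 at this
    omega
  obtain ⟨c, hc⟩ := card_eq_one.1 hc
  have hm : c ∈ ν.cells \ κ.cells := hc ▸ mem_singleton_self c
  refine ⟨c, (mem_sdiff.1 hm).2, ?_⟩
  rw [insert_eq, ← hc, sdiff_union_of_subset hs]

theorem mem_or_eq_of_up {κ ν : YoungDiagram} {r s : ℕ} (hν : ν.cells = insert (r, s) κ.cells)
    {c : ℕ × ℕ} (hc : c ∈ ν) : c = (r, s) ∨ c ∈ κ := by
  rw [← YoungDiagram.mem_cells, hν, mem_insert, YoungDiagram.mem_cells] at hc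
  exact hc

theorem exists_addBox_of_up {κ ν : YoungDiagram} (h : Up κ ν) :
    ∃ r, Addable κ r ∧ ν = addBox κ r := by
  obtain ⟨⟨r, j⟩, hc, hν⟩ := exists_eq_insert_of_up h
  have hm : (r, j) ∈ ν := by rw [← YoungDiagram.mem_cells, hν]; exact mem_insert_self _ _
  rw [YoungDiagram.mem_cells, YoungDiagram.mem_iff_lt_rowLen, not_lt] at hc
  have hj : j = κ.rowLen r := by
    by_contra hne
    have h1 : (r, κ.rowLen r) ∈ ν := ν.up_left_mem le_rfl hc hm
    rcases mem_or_eq_of_up hν h1 with h2 | h2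
    · exact hne (Prod.mk.inj h2).2.symm
    · exact notMem_cells_rowLen κ r ((YoungDiagram.mem_cells _).2 h2)
  subst hj
  have hadd : Addable κ r := by
    rintro s rfl
    have h1 : (s, κ.rowLen (s + 1)) ∈ ν := ν.up_left_mem (Nat.le_succ s) le_rfl hm
    rcases mem_or_eq_of_up hν h1 with h2 | h2
    · have := (Prod.mk.inj h2).1
      omega
    · exact YoungDiagram.mem_iff_lt_rowLen.1 h2
  exact ⟨r, hadd, YoungDiagram.ext (by rw [cells_addBox hadd, hν])⟩

theorem exists_removeBox_of_up {κ ν : YoungDiagram} (h : Up κ ν) :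
    ∃ r, Removable ν r ∧ κ = removeBox ν r := by
  obtain ⟨⟨r, j⟩, hc, hν⟩ := exists_eq_insert_of_up h
  have hm : (r, j) ∈ ν := by rw [← YoungDiagram.mem_cells, hν]; exact mem_insert_self _ _
  rw [YoungDiagram.mem_cells] at hc
  have hlt := YoungDiagram.mem_iff_lt_rowLen.1 hm
  have hj : ν.rowLen r - 1 = j := by
    by_contra hne
    have h1 : (r, ν.rowLen r - 1) ∈ ν := YoungDiagram.mem_iff_lt_rowLen.2 (by omega)
    rcases mem_or_eq_of_up hν h1 with h2 | h2
    · exact hne (Prod.mk.inj h2).2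
    · exact hc (κ.up_left_mem le_rfl (by omega) h2)
  have hrem : Removable ν r := by
    by_contra hr
    unfold Removable at hr
    have h1 : (r + 1, j) ∈ ν := YoungDiagram.mem_iff_lt_rowLen.2 (by omega)
    rcases mem_or_eq_of_up hν h1 with h2 | h2
    · have := (Prod.mk.inj h2).1
      omega
    · exact hc (κ.up_left_mem (Nat.le_succ r) le_rfl h2)
  refine ⟨r, hrem, YoungDiagram.ext ?_⟩
  rw [cells_removeBox hrem, hj, hν, erase_insert]
  rwa [YoungDiagram.mem_cells]

theorem removeBox_injOn (ν : YoungDiagram) : Set.InjOn (removeBox ν) {r | Removable ν r} := by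
  intro r hr s hs h
  by_contra hne
  have h1 := rowLen_removeBox_self hr
  rw [h, rowLen_removeBox_of_ne hne] at h1
  simp only [Set.mem_ofPred_eq, Removable] at hr
  omega

theorem addBox_injOn (ν : YoungDiagram) : Set.InjOn (addBox ν) {r | Addable ν r} := by
  intro r hr s hs h
  have h1 : (r, ν.rowLen r) ∈ (addBox ν r).cells := by
    rw [cells_addBox hr]; exact mem_insert_self _ _
  rw [h, cells_addBox hs, mem_insert] at h1
  rcases h1 with h1 | h1
  · exact (Prod.mk.inj h1).1
  · exact absurd h1 (notMem_cells_rowLen ν r)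

open Classical in
theorem sum_lower {M : Type*} [AddCommMonoid M] {ν : YoungDiagram} {N : ℕ}
    (hN : ν.rowLen N = 0) (h : YoungDiagram → M) :
    ∑ κ ∈ lower ν, h κ = ∑ r ∈ range N, if Removable ν r then h (removeBox ν r) else 0 := by
  rw [← sum_filter]
  have : lower ν = ((range N).filter (Removable ν)).image (removeBox ν) := by
    ext κ
    simp only [mem_lower, mem_image, mem_filter, mem_range]
    constructor
    · intro hκ
      obtain ⟨r, hr, rfl⟩ := exists_removeBox_of_up hκ
      refine ⟨r, ⟨?_, hr⟩, rfl⟩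
      by_contra hrN
      have := rowLen_eq_zero_of_le hN (not_lt.1 hrN)
      unfold Removable at hr
      omega
    · rintro ⟨r, ⟨-, hr⟩, rfl⟩
      exact up_removeBox hr
  rw [this, sum_image]
  intro r hr s hs
  exact removeBox_injOn ν (mem_filter.1 hr).2 (mem_filter.1 hs).2

open Classical in
-- Row N is empty but may receive a box, so the range is one longer than in `sum_lower`.
theorem sum_upper {M : Type*} [AddCommMonoid M] {κ : YoungDiagram} {N : ℕ}
    (hN : κ.rowLen N = 0) (h : YoungDiagram → M) :
    ∑ ν ∈ upper κ, h ν = ∑ r ∈ range (N + 1), if Addable κ r then h (addBox κ r) else 0 := by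
  rw [← sum_filter]
  have : upper κ = ((range (N + 1)).filter (Addable κ)).image (addBox κ) := by
    ext ν
    simp only [mem_upper, mem_image, mem_filter, mem_range]
    constructor
    · intro hν
      obtain ⟨r, hr, rfl⟩ := exists_addBox_of_up hν
      refine ⟨r, ⟨?_, hr⟩, rfl⟩
      by_contra hrN
      have := hr (r - 1) (by omega)
      have := rowLen_eq_zero_of_le hN (show N ≤ r - 1 by omega)
      omega
    · rintro ⟨r, ⟨-, hr⟩, rfl⟩
      exact up_addBox hr
  rw [this, sum_image]
  intro r hr s hs
  exact addBox_injOn κ (mem_filter.1 hr).2 (mem_filter.1 hs).2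

theorem poch_addBox {κ : YoungDiagram} {r : ℕ} (h : Addable κ r) (z : ℂ) :
    poch z (addBox κ r) κ = z + (κ.rowLen r : ℂ) - (r : ℂ) := by
  have : (addBox κ r).cells \ κ.cells = {(r, κ.rowLen r)} := by
    rw [cells_addBox h, insert_sdiff_of_notMem _ (notMem_cells_rowLen κ r), sdiff_self]
    rfl
  rw [poch, this, prod_singleton]

theorem poch_removeBox {ν : YoungDiagram} {r : ℕ} (h : Removable ν r) (z : ℂ) :
    poch z ν (removeBox ν r) = z + (ν.rowLen r : ℂ) - 1 - (r : ℂ) := by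
  have : ν.cells \ (removeBox ν r).cells = {(r, ν.rowLen r - 1)} := by
    rw [cells_removeBox h, sdiff_erase_self (mem_cells_of_removable h)]
  rw [poch, this, prod_singleton]
  have : 1 ≤ ν.rowLen r := by
    unfold Removable at h
    omega
  push_cast [Nat.cast_sub this]
  ring

/-! ### Chains -/

/-- The number of chains with `k` steps from `μ` to `ν`. -/
noncomputable def chainCount (k : ℕ) (μ ν : YoungDiagram) : ℕ :=
  Nat.card {c : Fin (k + 1) → YoungDiagram //
    c 0 = μ ∧ c (Fin.last _) = ν ∧ ∀ i : Fin k, Up (c i.castSucc) (c i.succ)}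

theorem dimSkew_eq_chainCount (μ ν : YoungDiagram) :
    dimSkew μ ν = chainCount (ν.card - μ.card) μ ν := rfl

theorem chainCount_zero_self (μ : YoungDiagram) : chainCount 0 μ μ = 1 := by
  rw [chainCount, Nat.card_eq_one_iff_unique]
  refine ⟨⟨fun a b => Subtype.ext (funext fun i => ?_)⟩, ⟨⟨fun _ => μ, rfl, rfl, fun i => i.elim0⟩⟩⟩
  rw [Fin.fin_one_eq_zero i, a.2.1, b.2.1]

theorem chainCount_zero_of_ne {μ ν : YoungDiagram} (h : μ ≠ ν) : chainCount 0 μ ν = 0 := by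
  rw [chainCount]
  have : IsEmpty {c : Fin (0 + 1) → YoungDiagram //
    c 0 = μ ∧ c (Fin.last _) = ν ∧ ∀ i : Fin 0, Up (c i.castSucc) (c i.succ)} :=
    ⟨fun c => h (c.2.1.symm.trans c.2.2.1)⟩
  exact Nat.card_of_isEmpty

/-- A chain with `k + 1` steps to `ν` is a chain with `k` steps to some `κ ↗ ν`. -/
def chainSuccEquiv (k : ℕ) (μ ν : YoungDiagram) :
    {c : Fin (k + 1 + 1) → YoungDiagram //
      c 0 = μ ∧ c (Fin.last _) = ν ∧ ∀ i : Fin (k + 1), Up (c i.castSucc) (c i.succ)} ≃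
    Σ κ : lower ν, {c : Fin (k + 1) → YoungDiagram //
      c 0 = μ ∧ c (Fin.last _) = κ.1 ∧ ∀ i : Fin k, Up (c i.castSucc) (c i.succ)} where
  toFun c := ⟨⟨c.1 (Fin.last k).castSucc, mem_lower.2 (by
      have := c.2.2.2 (Fin.last k)
      rwa [Fin.succ_last, c.2.2.1] at this)⟩,
    ⟨fun i => c.1 i.castSucc, c.2.1, rfl, fun i => c.2.2.2 i.castSucc⟩⟩
  invFun d := ⟨Fin.snoc (α := fun _ => YoungDiagram) d.2.1 ν, by
    refine ⟨?_, Fin.snoc_last _ _, fun i => ?_⟩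
    · exact (Fin.snoc_castSucc (α := fun _ => YoungDiagram) ν d.2.1 0).trans d.2.2.1
    · rw [Fin.snoc_castSucc]
      refine Fin.lastCases ?_ (fun i => ?_) i
      · rw [Fin.succ_last, Fin.snoc_last, d.2.2.2.1]
        exact mem_lower.1 d.1.2
      · rw [Fin.succ_castSucc, Fin.snoc_castSucc]
        exact d.2.2.2.2 i⟩
  left_inv c := by
    refine Subtype.ext (funext fun i => ?_)
    refine Fin.lastCases ?_ (fun i => ?_) i
    · simp only [Fin.snoc_last]
      exact c.2.2.1.symm
    · simp only [Fin.snoc_castSucc]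
  right_inv d := by
    -- The intermediate diagram is the last term of the shorter chain, so the chain alone determines
    -- the pair.
    have key : ∀ p q : (Σ κ : lower ν, {c : Fin (k + 1) → YoungDiagram //
        c 0 = μ ∧ c (Fin.last _) = κ.1 ∧ ∀ i : Fin k, Up (c i.castSucc) (c i.succ)}),
        p.2.1 = q.2.1 → p = q := by
      rintro ⟨⟨κ, hκ⟩, c, h0, h1, h2⟩ ⟨⟨κ', hκ'⟩, c', h0', h1', h2'⟩ h
      simp only at h h1 h1'
      subst h h1 h1'
      rfl
    exact key _ _ (funext fun i => Fin.snoc_castSucc (α := fun _ => YoungDiagram) ν d.2.1 i)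

theorem finite_chains (k : ℕ) (μ ν : YoungDiagram) :
    Finite {c : Fin (k + 1) → YoungDiagram //
      c 0 = μ ∧ c (Fin.last _) = ν ∧ ∀ i : Fin k, Up (c i.castSucc) (c i.succ)} := by
  induction k generalizing ν with
  | zero =>
    have : Subsingleton {c : Fin (0 + 1) → YoungDiagram //
        c 0 = μ ∧ c (Fin.last _) = ν ∧ ∀ i : Fin 0, Up (c i.castSucc) (c i.succ)} :=
      ⟨fun a b => Subtype.ext (funext fun i => by
        rw [Fin.fin_one_eq_zero i, a.2.1, b.2.1])⟩
    infer_instance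
  | succ k ih =>
    have := fun κ : lower ν => ih κ.1
    exact Finite.of_equiv _ (chainSuccEquiv k μ ν).symm

theorem chainCount_succ (k : ℕ) (μ ν : YoungDiagram) :
    chainCount (k + 1) μ ν = ∑ κ ∈ lower ν, chainCount k μ κ := by
  have := fun κ : lower ν => finite_chains k μ κ.1
  rw [chainCount, Nat.card_congr (chainSuccEquiv k μ ν), Nat.card_sigma,
    ← Finset.sum_coe_sort (lower ν)]
  rfl

theorem dimSkew_eq_sum_lower {μ ν : YoungDiagram} (h : μ.card < ν.card) :
    dimSkew μ ν = ∑ κ ∈ lower ν, dimSkew μ κ := by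
  obtain ⟨k, hk⟩ : ∃ k, ν.card - μ.card = k + 1 := ⟨ν.card - μ.card - 1, by omega⟩
  rw [dimSkew_eq_chainCount, hk, chainCount_succ]
  refine sum_congr rfl fun κ hκ => ?_
  have := (mem_lower.1 hκ).2
  rw [dimSkew_eq_chainCount]
  congr 1
  omega

theorem dimSkew_self (μ : YoungDiagram) : dimSkew μ μ = 1 := by
  rw [dimSkew_eq_chainCount, Nat.sub_self, chainCount_zero_self]

/-- The truncated difference of sizes is 0 here, and a chain without steps cannot join distinct
diagrams. -/
theorem dimSkew_of_card_le {μ ν : YoungDiagram} (h : ν.card ≤ μ.card) (hne : μ ≠ ν) :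
    dimSkew μ ν = 0 := by
  rw [dimSkew_eq_chainCount, Nat.sub_eq_zero_of_le h, chainCount_zero_of_ne hne]

theorem eq_bot_of_card_eq_zero {ν : YoungDiagram} (h : ν.card = 0) : ν = ⊥ :=
  YoungDiagram.ext (by rw [Finset.card_eq_zero.1 h]; rfl)

theorem card_bot : (⊥ : YoungDiagram).card = 0 := rfl

theorem exists_removable {ν : YoungDiagram} (h : 0 < ν.card) : ∃ r, Removable ν r := by
  by_contra hr
  simp only [Removable, not_exists, not_lt] at hr
  have h0 : ∀ r, ν.rowLen 0 ≤ ν.rowLen r := by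
    intro r
    induction r with
    | zero => exact le_rfl
    | succ r ih => exact ih.trans (hr r)
  have hN := rowLen_eq_zero_of_card_le (le_refl ν.card)
  have h00 : ν.rowLen 0 = 0 := Nat.le_zero.1 (hN ▸ h0 ν.card)
  have := card_eq_sum_rowLen h00
  rw [range_zero, sum_empty] at this
  omega

theorem dim_pos (ν : YoungDiagram) : 0 < dim ν := by
  induction hn : ν.card generalizing ν with
  | zero =>
    rw [eq_bot_of_card_eq_zero hn, dim, dimSkew_self]
    exact one_pos
  | succ n ih =>
    have hν : 0 < ν.card := by omega
    obtain ⟨r, hr⟩ := exists_removable hν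
    have hup := up_removeBox hr
    rw [dim, dimSkew_eq_sum_lower (by rw [card_bot]; exact hν)]
    have h1 := ih (removeBox ν r) (by have := hup.2; omega)
    exact lt_of_lt_of_le h1
      (single_le_sum (f := fun κ => dimSkew ⊥ κ) (fun _ _ => Nat.zero_le _) (mem_lower.2 hup))

section

/-! ### Determinants of falling factorials -/

section Det

variable {R ι : Type*} [CommRing R] [Fintype ι] [DecidableEq ι]

theorem prod_updateCol_mul (M : Matrix ι ι R) (σ : Equiv.Perm ι) (s : ι) (w : ι → R) :
    ∏ i, M.updateCol s (fun r => w r * M r s) (σ i) i = w (σ s) * ∏ i, M (σ i) i := by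
  rw [← mul_prod_erase univ _ (mem_univ s), ← mul_prod_erase univ (fun i => M (σ i) i) (mem_univ s),
    Matrix.updateCol_self, mul_assoc]
  congr 2
  refine prod_congr rfl fun i hi => ?_
  rw [Matrix.updateCol_ne (ne_of_mem_erase hi)]

/-- In the expansion over permutations, the term of σ is multiplied by w (σ s); summing over s gives
the full sum of w, whatever σ is. -/
theorem sum_det_updateCol_mul (M : Matrix ι ι R) (w : ι → R) :
    ∑ s, (M.updateCol s (fun r => w r * M r s)).det = (∑ r, w r) * M.det := by
  simp_rw [Matrix.det_apply', prod_updateCol_mul]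
  rw [sum_comm, mul_sum]
  refine sum_congr rfl fun σ _ => ?_
  rw [← Equiv.sum_comp σ w, sum_mul]
  refine sum_congr rfl fun s _ => ?_
  ring

theorem sum_det_updateRow_mul (M : Matrix ι ι R) (w : ι → R) :
    ∑ r, (M.updateRow r (fun s => w s * M r s)).det = (∑ s, w s) * M.det := by
  have h := sum_det_updateCol_mul M.transpose w
  rw [Matrix.det_transpose] at h
  rw [← h]
  refine sum_congr rfl fun r _ => ?_
  rw [Matrix.updateCol_transpose, Matrix.det_transpose]
  rfl

end Det

section Alt

variable (R : Type*) [CommRing R] {N : ℕ}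

/-- The alternant `det (l_r (l_r - 1) ⋯ (l_r - e_s + 1))`. -/
noncomputable def alt (e l : Fin N → ℕ) : R :=
  (Matrix.of fun r s => ((l r).descFactorial (e s) : R)).det

/-- Write (x)_k for the falling factorial. Since l·(l-1)_k = (l-k)·(l)_k, lowering l_r and
multiplying by l_r gives l_r times the alternant minus the determinant whose row r is scaled
entrywise by e. Summed over r, the latter is `sum_det_updateRow_mul`. This identity is the alternant
form of the branching rule. -/
theorem sum_mul_alt_update_sub_one (e l : Fin N → ℕ) :
    ∑ r, (l r : R) * alt R e (Function.update l r (l r - 1)) =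
      (∑ r, (l r : R) - ∑ s, (e s : R)) * alt R e l := by
  set M : Matrix (Fin N) (Fin N) R := Matrix.of fun r s => ((l r).descFactorial (e s) : R) with hM
  have hrow : ∀ r, (l r : R) * alt R e (Function.update l r (l r - 1)) =
      (l r : R) * M.det - (M.updateRow r (fun s => (e s : R) * M r s)).det := by
    intro r
    have h1 : (Matrix.of fun r' s =>
        ((Function.update l r (l r - 1) r').descFactorial (e s) : R)) =
        M.updateRow r (fun s => ((l r - 1).descFactorial (e s) : R)) := by
      ext r' s
      by_cases h : r' = r
      · subst h
        simp
      · simp [h, hM]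
    have h2 : (l r : R) • (fun s => ((l r - 1).descFactorial (e s) : R)) =
        (l r : R) • M r + (-1 : R) • (fun s => (e s : R) * M r s) := by
      ext s
      have h3 : l r * (l r - 1).descFactorial (e s) + e s * (l r).descFactorial (e s) =
          l r * (l r).descFactorial (e s) := by
        rcases hl : l r with _ | m
        · rcases e s with _ | k <;> simp
        · rw [Nat.add_sub_cancel, ← Nat.succ_descFactorial_succ, Nat.descFactorial_succ]
          by_cases hle : e s ≤ m + 1
          · rw [← add_mul, Nat.sub_add_cancel hle]
          · rw [Nat.descFactorial_eq_zero_iff_lt.2 (by omega : m + 1 < e s)]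
            simp
      have h4 : (l r : R) * ((l r - 1).descFactorial (e s) : R) +
          (e s : R) * ((l r).descFactorial (e s) : R) =
          (l r : R) * ((l r).descFactorial (e s) : R) := by exact_mod_cast congrArg (Nat.cast (R := R)) h3
      simp only [Pi.smul_apply, Pi.add_apply, smul_eq_mul, hM, Matrix.of_apply]
      linear_combination h4
    rw [alt, h1, ← Matrix.det_updateRow_smul, h2, Matrix.det_updateRow_add,
      Matrix.det_updateRow_smul, Matrix.det_updateRow_smul, Matrix.updateRow_eq_self]
    ring
  rw [sum_congr rfl fun r _ => hrow r, sum_sub_distrib, sum_det_updateRow_mul, ← sum_mul, sub_mul]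
  rfl

theorem alt_eq_zero_of_eq {e l : Fin N → ℕ} {i j : Fin N} (hij : i ≠ j) (h : l i = l j) :
    alt R e l = 0 :=
  Matrix.det_zero_of_row_eq hij (by ext s; simp [h])

theorem alt_eq_zero_of_forall {e l : Fin N → ℕ}
    (h : ∀ σ : Equiv.Perm (Fin N), ∃ i, l (σ i) < e i) : alt R e l = 0 := by
  rw [alt, Matrix.det_apply']
  refine sum_eq_zero fun σ _ => ?_
  obtain ⟨i, hi⟩ := h σ
  rw [prod_eq_zero (mem_univ i), mul_zero]
  rw [Matrix.of_apply, Nat.descFactorial_eq_zero_iff_lt.2 hi, Nat.cast_zero]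

variable {R}

theorem eq_one_of_strictAnti_comp {l : Fin N → ℕ} (hl : StrictAnti l) {e : Fin N → ℕ}
    (he : StrictAnti e) {σ : Equiv.Perm (Fin N)} (h : ∀ i, l (σ i) = e i) : σ = 1 := by
  have hmono : StrictMono σ := by
    intro i j hij
    by_contra hc
    have h1 := hl.antitone (not_lt.1 hc)
    rw [h, h] at h1
    exact absurd (he hij) (not_lt.2 h1)
  ext i
  have : (⇑σ : Fin N → Fin N) = id := by
    refine StrictMono.range_inj hmono strictMono_id |>.1 ?_
    rw [Set.range_id, σ.surjective.range_eq]
  simp [this]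

variable (R)

/-- A nonzero term of the expansion needs e i ≤ l (σ i) for all i. The bound on the sums then forces
equality throughout, hence σ = 1 and e = l. -/
theorem alt_eq_zero_of_sum_le {e l : Fin N → ℕ} (he : StrictAnti e) (hl : StrictAnti l)
    (hsum : ∑ i, l i ≤ ∑ i, e i) (hne : e ≠ l) : alt R e l = 0 := by
  refine alt_eq_zero_of_forall R fun σ => ?_
  by_contra hc
  simp only [not_exists, not_lt] at hc
  have h1 : ∑ i, e i ≤ ∑ i, l (σ i) := sum_le_sum fun i _ => hc i
  have h2 : ∑ i, e i = ∑ i, l (σ i) := le_antisymm h1 (by rwa [Equiv.sum_comp σ l])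
  have h3 := (sum_eq_sum_iff_of_le fun i _ => hc i).1 h2
  have h4 := eq_one_of_strictAnti_comp hl he (fun i => (h3 i (mem_univ i)).symm)
  subst h4
  exact hne (funext fun i => h3 i (mem_univ i))

theorem alt_self {l : Fin N → ℕ} (hl : StrictAnti l) :
    alt R l l = ∏ i, ((l i).factorial : R) := by
  rw [alt, Matrix.det_apply', sum_eq_single 1]
  · simp [Nat.descFactorial_self]
  · intro σ _ hσ
    have : ∃ i, l (σ i) < l i := by
      by_contra hc
      simp only [not_exists, not_lt] at hc
      have h2 : ∑ i, l i = ∑ i, l (σ i) := (Equiv.sum_comp σ l).symm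
      have h3 := (sum_eq_sum_iff_of_le fun i _ => hc i).1 h2
      exact hσ (eq_one_of_strictAnti_comp hl hl (fun i => (h3 i (mem_univ i)).symm))
    obtain ⟨i, hi⟩ := this
    rw [prod_eq_zero (mem_univ i), mul_zero]
    rw [Matrix.of_apply, Nat.descFactorial_eq_zero_iff_lt.2 hi, Nat.cast_zero]
  · simp

end Alt

/-! ### Shifted row lengths and the determinantal formula for `dim` -/

/-- The shifted row lengths `ν_r + N - 1 - r`. -/
def beta (N : ℕ) (ν : YoungDiagram) (r : Fin N) : ℕ := ν.rowLen r + (N - 1 - r)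

theorem beta_strictAnti (N : ℕ) (ν : YoungDiagram) : StrictAnti (beta N ν) := by
  intro r s hrs
  have := ν.rowLen_anti r s hrs.le
  have h1 : (r : ℕ) < s := hrs
  have h2 := s.2
  unfold beta
  omega

theorem beta_injective {N : ℕ} {κ ν : YoungDiagram} (hκ : κ.rowLen N = 0) (hν : ν.rowLen N = 0)
    (h : beta N κ = beta N ν) : κ = ν := by
  refine ext_rowLen fun i => ?_
  by_cases hi : i < N
  · have := congrFun h ⟨i, hi⟩
    simp only [beta] at this
    omega
  · rw [rowLen_eq_zero_of_le hκ (not_lt.1 hi), rowLen_eq_zero_of_le hν (not_lt.1 hi)]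

theorem sum_beta {N : ℕ} {ν : YoungDiagram} (hν : ν.rowLen N = 0) :
    ∑ r, beta N ν r = ν.card + ∑ r : Fin N, (N - 1 - r) := by
  rw [card_eq_sum_rowLen hν, ← Fin.sum_univ_eq_sum_range, ← sum_add_distrib]
  rfl

theorem beta_removeBox {N : ℕ} {ν : YoungDiagram} {r : Fin N} (h : Removable ν r) :
    beta N (removeBox ν r) = Function.update (beta N ν) r (beta N ν r - 1) := by
  ext s
  by_cases hs : s = r
  · subst hs
    rw [Function.update_self, beta, rowLen_removeBox_self h, beta]
    unfold Removable at h
    omega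
  · rw [Function.update_of_ne hs, beta, rowLen_removeBox_of_ne (fun h => hs (Fin.ext h)), beta]

theorem rowLen_removeBox_eq_zero {N : ℕ} {ν : YoungDiagram} (hν : ν.rowLen N = 0) (r : ℕ) :
    (removeBox ν r).rowLen N = 0 := by
  by_cases h : Removable ν r
  · have := (up_removeBox h).1
    by_contra h0
    have h1 : (N, 0) ∈ removeBox ν r := YoungDiagram.mem_iff_lt_rowLen.2 (by omega)
    have h2 := YoungDiagram.mem_iff_lt_rowLen.1 (this h1)
    omega
  · rwa [removeBox, dif_neg h]

variable (R : Type*) [CommRing R]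

/-- Rows r and r + 1 have equal length, so lowering the shifted length of row r makes two rows of
the determinant equal. For the last row r = N - 1 the shifted length itself is 0. -/
theorem mul_alt_beta_eq_zero_of_not_removable {N : ℕ} {ν : YoungDiagram} (hν : ν.rowLen N = 0)
    {r : Fin N} (h : ¬ Removable ν r) (e : Fin N → ℕ) :
    (beta N ν r : R) * alt R e (Function.update (beta N ν) r (beta N ν r - 1)) = 0 := by
  have hr := ν.rowLen_anti r (r + 1) (Nat.le_succ _)
  unfold Removable at h
  have hr2 := r.2
  by_cases hN : (r : ℕ) + 1 < N
  · have hne : r ≠ ⟨r + 1, hN⟩ := fun h => by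
      have := congrArg Fin.val h
      simp at this
    rw [alt_eq_zero_of_eq R hne, mul_zero]
    rw [Function.update_self, Function.update_of_ne hne.symm]
    simp only [beta]
    omega
  · have h1 : (r : ℕ) + 1 = N := by omega
    have h2 : beta N ν r = 0 := by
      rw [h1, hν] at h
      unfold beta
      omega
    rw [h2, Nat.cast_zero, zero_mul]

theorem prod_factorial_removeBox {N : ℕ} {ν : YoungDiagram} {r : Fin N} (h : Removable ν r) :
    ∏ i, (beta N ν i).factorial =
      beta N ν r * ∏ i, (beta N (removeBox ν r) i).factorial := by
  have hpos : beta N ν r ≠ 0 := by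
    unfold Removable at h
    unfold beta
    omega
  rw [beta_removeBox h, ← mul_prod_erase univ _ (mem_univ r),
    ← mul_prod_erase univ (fun i => (Function.update (beta N ν) r (beta N ν r - 1) i).factorial)
      (mem_univ r), Function.update_self, ← mul_assoc, Nat.mul_factorial_pred hpos]
  congr 1
  refine prod_congr rfl fun i hi => ?_
  rw [Function.update_of_ne (ne_of_mem_erase hi)]

/-- Removing a box from row r divides the product of factorials by `beta N ν r`, which turns the sum
over `lower ν` into the left side of `sum_mul_alt_update_sub_one`; the rows without a removable box
contribute nothing there. -/
theorem sum_lower_prod_factorial_mul {N : ℕ} {ν : YoungDiagram} (hν : ν.rowLen N = 0)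
    (F : YoungDiagram → R) (e : Fin N → ℕ)
    (hF : ∀ κ ∈ lower ν, F κ * (∏ i, (beta N κ i).factorial : ℕ) = alt R e (beta N κ)) :
    (∑ κ ∈ lower ν, F κ) * (∏ i, (beta N ν i).factorial : ℕ) =
      (∑ r, (beta N ν r : R) - ∑ s, (e s : R)) * alt R e (beta N ν) := by
  classical
  rw [← sum_mul_alt_update_sub_one, sum_lower hν, ← Fin.sum_univ_eq_sum_range
    (fun r => if Removable ν r then F (removeBox ν r) else 0), sum_mul]
  refine sum_congr rfl fun r _ => ?_
  split_ifs with h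
  · rw [prod_factorial_removeBox h, ← beta_removeBox h, ← hF _ (mem_lower.2 (up_removeBox h))]
    push_cast
    ring
  · rw [mul_alt_beta_eq_zero_of_not_removable R hν h, zero_mul]

/-- Both sides satisfy the branching recursion in ν and agree when |ν| ≤ |μ|, where only ν = μ
survives. -/
theorem dimSkew_mul_prod_factorial {N : ℕ} {μ ν : YoungDiagram} (hμ : μ.rowLen N = 0)
    (hν : ν.rowLen N = 0) (hle : μ.card ≤ ν.card) :
    (dimSkew μ ν : ℚ) * (∏ i, (beta N ν i).factorial : ℕ) =
      ((ν.card - μ.card).factorial : ℚ) * alt ℚ (beta N μ) (beta N ν) := by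
  induction hk : ν.card - μ.card generalizing ν with
  | zero =>
    by_cases h : μ = ν
    · subst h
      rw [dimSkew_self, alt_self ℚ (beta_strictAnti N μ)]
      push_cast
      simp
    · rw [dimSkew_of_card_le (by omega) h, alt_eq_zero_of_sum_le ℚ (beta_strictAnti N μ)
        (beta_strictAnti N ν)]
      · simp
      · rw [sum_beta hμ, sum_beta hν]
        omega
      · exact fun h' => h (beta_injective hμ hν h')
  | succ k ih =>
    -- Dividing by k! reduces the inductive formula for the smaller diagrams to a bare alternant.
    have key := sum_lower_prod_factorial_mul ℚ hν
      (fun κ => (dimSkew μ κ : ℚ) / (k.factorial : ℚ)) (beta N μ) (by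
        intro κ hκ
        obtain ⟨r, hr, rfl⟩ := exists_removeBox_of_up (mem_lower.1 hκ)
        have hc := (mem_lower.1 hκ).2
        have := ih (rowLen_removeBox_eq_zero hν r) (by omega) (by omega)
        have hk0 : (k.factorial : ℚ) ≠ 0 := by exact_mod_cast k.factorial_ne_zero
        rw [div_mul_eq_mul_div, this]
        field_simp)
    have h1 : (∑ r, (beta N ν r : ℚ) - ∑ s, (beta N μ s : ℚ)) = k + 1 := by
      rw [← Nat.cast_sum, ← Nat.cast_sum, sum_beta hμ, sum_beta hν]
      have : ν.card = μ.card + (k + 1) := by omega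
      rw [this]
      push_cast
      ring
    rw [h1, ← sum_div] at key
    rw [dimSkew_eq_sum_lower (by omega), Nat.factorial_succ]
    have hk0 : (k.factorial : ℚ) ≠ 0 := by exact_mod_cast k.factorial_ne_zero
    field_simp at key
    push_cast at key ⊢
    linear_combination key

theorem card_bot_rowLen (N : ℕ) : (⊥ : YoungDiagram).rowLen N = 0 :=
  rowLen_eq_zero_of_card_le (Nat.zero_le N)

theorem alt_cast {N : ℕ} (e l : Fin N → ℕ) : alt R e l = ((alt ℤ e l : ℤ) : R) := by
  rw [alt, alt, ← eq_intCast (Int.castRingHom R), RingHom.map_det]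
  congr 1
  ext r s
  simp

/-- The exponents of `beta N ⊥` are N-1, …, 0, so this is a Vandermonde determinant. Its
nonvanishing is read off from dim ν > 0 over ℚ, then passed to 𝕜 through ℤ. -/
theorem alt_bot_ne_zero (𝕜 : Type*) [Field 𝕜] [CharZero 𝕜] {N : ℕ} {ν : YoungDiagram}
    (hν : ν.rowLen N = 0) : alt 𝕜 (beta N ⊥) (beta N ν) ≠ 0 := by
  have h := dimSkew_mul_prod_factorial (card_bot_rowLen N) hν (Nat.zero_le _)
  have h1 : alt ℚ (beta N ⊥) (beta N ν) ≠ 0 := by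
    intro h0
    rw [h0, mul_zero] at h
    have h2 : (dimSkew ⊥ ν : ℚ) ≠ 0 := by exact_mod_cast (dim_pos ν).ne'
    have h3 : ((∏ i, (beta N ν i).factorial : ℕ) : ℚ) ≠ 0 := by
      exact_mod_cast (prod_pos fun i _ => (beta N ν i).factorial_pos).ne'
    exact mul_ne_zero h2 h3 h
  rw [alt_cast] at h1 ⊢
  have h2 : alt ℤ (beta N ⊥) (beta N ν) ≠ 0 := by
    intro h
    rw [h] at h1
    exact h1 rfl
  exact_mod_cast h2

/-- Divide the determinantal formula for dim(μ,ν) by the one for dim ν: the products of factorials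
cancel, and the remaining factorials make up the falling factorial of `fsFun`. If |μ| > |ν| both
sides vanish. -/
theorem fsFun_mul_alt (𝕜 : Type*) [Field 𝕜] [CharZero 𝕜] {N : ℕ} {μ ν : YoungDiagram}
    (hμ : μ.rowLen N = 0) (hν : ν.rowLen N = 0) :
    fsFun 𝕜 μ ν * alt 𝕜 (beta N ⊥) (beta N ν) = alt 𝕜 (beta N μ) (beta N ν) := by
  by_cases hle : μ.card ≤ ν.card
  · have h1 := dimSkew_mul_prod_factorial hμ hν hle
    have h2 := dimSkew_mul_prod_factorial (card_bot_rowLen N) hν (Nat.zero_le _)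
    have h3 : ((ν.card - μ.card).factorial : ℚ) * (ν.card.descFactorial μ.card : ℚ) =
        (ν.card.factorial : ℚ) := by
      exact_mod_cast Nat.factorial_mul_descFactorial hle
    have hP : ((∏ i, (beta N ν i).factorial : ℕ) : ℚ) ≠ 0 := by
      exact_mod_cast (prod_pos fun i _ => (beta N ν i).factorial_pos).ne'
    have hf : ((ν.card - μ.card).factorial : ℚ) ≠ 0 := by
      exact_mod_cast Nat.factorial_ne_zero _
    have key : (ν.card.descFactorial μ.card : ℚ) * (dimSkew μ ν : ℚ) *
        alt ℚ (beta N ⊥) (beta N ν) = (dim ν : ℚ) * alt ℚ (beta N μ) (beta N ν) := by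
      rw [card_bot, Nat.sub_zero] at h2
      rw [dim]
      refine mul_right_cancel₀ hP (mul_left_cancel₀ hf ?_)
      linear_combination (-(alt ℚ (beta N μ) (beta N ν)) * ((ν.card - μ.card).factorial : ℚ)) * h2 +
        ((ν.card.factorial : ℚ) * alt ℚ (beta N ⊥) (beta N ν)) * h1 +
        (dimSkew μ ν : ℚ) * alt ℚ (beta N ⊥) (beta N ν) *
          ((∏ i, (beta N ν i).factorial : ℕ) : ℚ) * h3
    rw [alt_cast ℚ (beta N ⊥), alt_cast ℚ (beta N μ)] at key
    have key' : (ν.card.descFactorial μ.card : ℤ) * (dimSkew μ ν : ℤ) *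
        alt ℤ (beta N ⊥) (beta N ν) = (dim ν : ℤ) * alt ℤ (beta N μ) (beta N ν) := by
      exact_mod_cast key
    have key'' := congrArg (Int.cast (R := 𝕜)) key'
    push_cast at key''
    have hd : (dim ν : 𝕜) ≠ 0 := by exact_mod_cast (dim_pos ν).ne'
    rw [alt_cast 𝕜 (beta N ⊥), alt_cast 𝕜 (beta N μ), fsFun]
    field_simp
    linear_combination key''
  · rw [fsFun, Nat.descFactorial_eq_zero_iff_lt.2 (not_le.1 hle), Nat.cast_zero, zero_mul,
      zero_mul, alt_eq_zero_of_sum_le 𝕜 (beta_strictAnti N μ) (beta_strictAnti N ν)]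
    · rw [sum_beta hμ, sum_beta hν]
      omega
    · intro h
      rw [beta_injective hμ hν h] at hle
      exact hle le_rfl

end

/-! ### Kerov's operators -/

/-- The weight `(z)_{ν/κ} (z')_{ν/κ}`. -/
noncomputable def weight (z z' : ℂ) (ν κ : YoungDiagram) : ℂ := poch z ν κ * poch z' ν κ

theorem poch_sup_left (z : ℂ) (κ ν : YoungDiagram) : poch z (κ ⊔ ν) κ = poch z ν (κ ⊓ ν) := by
  rw [poch, poch, YoungDiagram.cells_sup, YoungDiagram.cells_inf, union_sdiff_left,
    sdiff_inter_self_right]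

theorem card_sup_add_card_inf (κ ν : YoungDiagram) :
    (κ ⊔ ν).card + (κ ⊓ ν).card = κ.card + ν.card := by
  change (κ ⊔ ν).cells.card + (κ ⊓ ν).cells.card = κ.cells.card + ν.cells.card
  rw [YoungDiagram.cells_sup, YoungDiagram.cells_inf, card_union_add_card_inter]

theorem card_le_card {κ ν : YoungDiagram} (h : κ ≤ ν) : κ.card ≤ ν.card :=
  Finset.card_le_card (YoungDiagram.cells_subset_iff.2 h)

theorem lt_card_sup {κ ν : YoungDiagram} (hc : κ.card = ν.card) (hne : κ ≠ ν) :
    κ.card < (κ ⊔ ν).card := by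
  refine lt_of_le_of_ne (card_le_card le_sup_left) fun h => hne ?_
  have h1 : κ = κ ⊔ ν := eq_of_le_of_card_eq le_sup_left h
  have h2 : ν ≤ κ := by rw [h1]; exact le_sup_right
  exact (eq_of_le_of_card_eq h2 hc.symm).symm

theorem up_and_up_iff_sup {κ ν ρ : YoungDiagram} (hc : κ.card = ν.card) (hne : κ ≠ ν) :
    (Up κ ρ ∧ Up ν ρ) ↔ ρ = κ ⊔ ν ∧ (κ ⊓ ν).card + 1 = κ.card := by
  have h1 := lt_card_sup hc hne
  have h2 := card_sup_add_card_inf κ ν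
  constructor
  · rintro ⟨ha, hb⟩
    have h3 : κ ⊔ ν ≤ ρ := sup_le ha.1 hb.1
    have h4 := card_le_card h3
    have h5 := ha.2
    exact ⟨(eq_of_le_of_card_eq h3 (by omega)).symm, by omega⟩
  · rintro ⟨rfl, h⟩
    exact ⟨⟨le_sup_left, by omega⟩, ⟨le_sup_right, by omega⟩⟩

theorem up_and_up_iff_inf {κ ν ρ : YoungDiagram} (hc : κ.card = ν.card) (hne : κ ≠ ν) :
    (Up ρ κ ∧ Up ρ ν) ↔ ρ = κ ⊓ ν ∧ (κ ⊓ ν).card + 1 = κ.card := by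
  have h1 := lt_card_sup hc hne
  have h2 := card_sup_add_card_inf κ ν
  constructor
  · rintro ⟨ha, hb⟩
    have h3 : ρ ≤ κ ⊓ ν := le_inf ha.1 hb.1
    have h4 := card_le_card h3
    have h5 := ha.2
    exact ⟨eq_of_le_of_card_eq h3 (by omega), by omega⟩
  · rintro ⟨rfl, h⟩
    exact ⟨⟨inf_le_left, by omega⟩, ⟨inf_le_right, by omega⟩⟩

open Classical in
-- Off-diagonal part of the commutator. The only diagram one box above both is κ ⊔ ν, the only one
-- below both is κ ⊓ ν, and each exists exactly when the other does. The box of (κ ⊔ ν)/κ is that of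
-- ν/(κ ⊓ ν), so the weights agree.
theorem sum_upper_weight_eq_sum_lower_weight (z z' : ℂ) {κ ν : YoungDiagram}
    (hc : κ.card = ν.card) (hne : κ ≠ ν) :
    (∑ ρ ∈ upper κ, if Up ν ρ then weight z z' ρ κ else 0) =
      ∑ ρ ∈ lower κ, if Up ρ ν then weight z z' ν ρ else 0 := by
  rw [← sum_filter, ← sum_filter]
  by_cases h : (κ ⊓ ν).card + 1 = κ.card
  · have h1 : (upper κ).filter (fun ρ => Up ν ρ) = {κ ⊔ ν} := by
      ext ρ
      rw [mem_filter, mem_upper, up_and_up_iff_sup hc hne, mem_singleton]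
      simp [h]
    have h2 : (lower κ).filter (fun ρ => Up ρ ν) = {κ ⊓ ν} := by
      ext ρ
      rw [mem_filter, mem_lower, up_and_up_iff_inf hc hne, mem_singleton]
      simp [h]
    rw [h1, h2, sum_singleton, sum_singleton, weight, weight, poch_sup_left, poch_sup_left]
  · have h1 : (upper κ).filter (fun ρ => Up ν ρ) = ∅ := by
      ext ρ
      rw [mem_filter, mem_upper, up_and_up_iff_sup hc hne]
      simp [h]
    have h2 : (lower κ).filter (fun ρ => Up ρ ν) = ∅ := by
      ext ρ
      rw [mem_filter, mem_lower, up_and_up_iff_inf hc hne]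
      simp [h]
    rw [h1, h2, sum_empty, sum_empty]

theorem corner_sum {R : Type*} [CommRing R] (z z' : R) (ρ : ℕ → R) (N : ℕ) :
    (z + ρ 0) * (z' + ρ 0) + ∑ r ∈ range N,
      ((z + ρ (r + 1) - (r + 1)) * (z' + ρ (r + 1) - (r + 1)) -
        (z + ρ r - 1 - r) * (z' + ρ r - 1 - r)) =
      (z + ρ N - N) * (z' + ρ N - N) + N * (z + z') - N * N + 2 * ∑ r ∈ range N, ρ r := by
  induction N with
  | zero => simp
  | succ N ih =>
    rw [sum_range_succ, ← add_assoc, ih, sum_range_succ]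
    push_cast
    ring

/-- Diagonal part of the commutator. A box can be added in row r + 1 exactly when one can be removed
from row r. If neither is possible the two rows have equal length and the two contents in question
coincide, so all rows may be included and `corner_sum` applies. -/
theorem sum_upper_weight (z z' : ℂ) (κ : YoungDiagram) :
    ∑ ν ∈ upper κ, weight z z' ν κ =
      ∑ ρ ∈ lower κ, weight z z' κ ρ + (z * z' + 2 * (κ.card : ℂ)) := by
  classical
  set N := κ.card with hNdef
  have hN : κ.rowLen N = 0 := rowLen_eq_zero_of_card_le le_rfl
  have h0 : Addable κ 0 := fun s hs => by omega
  have hs : ∀ r, Addable κ (r + 1) ↔ Removable κ r := by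
    intro r
    unfold Addable Removable
    constructor
    · exact fun h => h r rfl
    · rintro h s hs
      obtain rfl : s = r := by omega
      exact h
  rw [sum_upper hN, sum_lower hN, sum_range_succ', if_pos h0, weight, poch_addBox h0,
    poch_addBox h0]
  have h1 : ∀ r ∈ range N,
      (if Addable κ (r + 1) then weight z z' (addBox κ (r + 1)) κ else 0) =
      (if Removable κ r then weight z z' κ (removeBox κ r) else 0) +
      ((z + κ.rowLen (r + 1) - (r + 1)) * (z' + κ.rowLen (r + 1) - (r + 1)) -
        (z + κ.rowLen r - 1 - r) * (z' + κ.rowLen r - 1 - r)) := by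
    intro r _
    by_cases h : Removable κ r
    · rw [if_pos h, if_pos ((hs r).2 h), weight, weight, poch_addBox ((hs r).2 h),
        poch_addBox ((hs r).2 h), poch_removeBox h, poch_removeBox h]
      push_cast
      ring
    · rw [if_neg h, if_neg (fun h' => h ((hs r).1 h'))]
      have h2 := κ.rowLen_anti r (r + 1) (Nat.le_succ r)
      unfold Removable at h
      rw [show κ.rowLen (r + 1) = κ.rowLen r by omega]
      ring
  rw [sum_congr rfl h1, sum_add_distrib]
  have h2 := corner_sum z z' (fun r => (κ.rowLen r : ℂ)) N
  rw [← Nat.cast_sum, ← card_eq_sum_rowLen hN, ← hNdef] at h2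
  -- With an empty row N, the terms (z - N)(z' - N) + N(z + z') - N² collapse to zz'.
  simp only [hN, Nat.cast_zero] at h2 ⊢
  linear_combination h2

/-- The diagrams with `n` boxes as a finite set. -/
noncomputable def levelFinset (n : ℕ) : Finset YoungDiagram :=
  (univ : Finset (Level n)).map (Function.Embedding.subtype _)

@[simp] theorem mem_levelFinset {n : ℕ} {ν : YoungDiagram} : ν ∈ levelFinset n ↔ ν.card = n := by
  simp [levelFinset]

theorem sum_level {M : Type*} [AddCommMonoid M] (n : ℕ) (F : YoungDiagram → M) :
    ∑ ν : Level n, F ν.1 = ∑ ν ∈ levelFinset n, F ν := by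
  rw [levelFinset, sum_map]
  rfl

open Classical in
theorem sum_levelFinset_ite_up_right {M : Type*} [AddCommMonoid M] {n : ℕ} {ν : YoungDiagram}
    (hν : ν.card = n + 1) (F : YoungDiagram → M) :
    (∑ κ ∈ levelFinset n, if Up κ ν then F κ else 0) = ∑ κ ∈ lower ν, F κ := by
  rw [← sum_filter]
  refine sum_congr (Finset.ext fun κ => ?_) fun _ _ => rfl
  simp only [mem_filter, mem_levelFinset, mem_lower, and_iff_right_iff_imp]
  exact fun h => by have := h.2; omega

open Classical in
theorem sum_levelFinset_ite_up_left {M : Type*} [AddCommMonoid M] {n : ℕ} {κ : YoungDiagram}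
    (hκ : κ.card = n) (F : YoungDiagram → M) :
    (∑ ν ∈ levelFinset (n + 1), if Up κ ν then F ν else 0) = ∑ ν ∈ upper κ, F ν := by
  rw [← sum_filter]
  refine sum_congr (Finset.ext fun ν => ?_) fun _ _ => rfl
  simp only [mem_filter, mem_levelFinset, mem_upper, and_iff_right_iff_imp]
  exact fun h => by have := h.2; omega

/-- Kerov's commutation relation. Both double sums are rewritten as sums over diagrams ρ with |ρ| =
|κ|, and the coefficients of h ρ are compared separately for ρ = κ and ρ ≠ κ. -/
theorem sum_upper_sum_lower (z z' : ℂ) (κ : YoungDiagram) (h : YoungDiagram → ℂ) :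
    ∑ ν ∈ upper κ, weight z z' ν κ * ∑ ρ ∈ lower ν, h ρ =
      ∑ σ ∈ lower κ, ∑ ρ ∈ upper σ, weight z z' ρ σ * h ρ +
        (z * z' + 2 * (κ.card : ℂ)) * h κ := by
  classical
  have hL : ∑ ν ∈ upper κ, weight z z' ν κ * ∑ ρ ∈ lower ν, h ρ =
      ∑ ρ ∈ levelFinset κ.card,
        (∑ ν ∈ upper κ, if Up ρ ν then weight z z' ν κ else 0) * h ρ := by
    simp_rw [sum_mul]
    rw [sum_comm]
    refine sum_congr rfl fun ν hν => ?_
    rw [← sum_levelFinset_ite_up_right (mem_upper.1 hν).2, mul_sum]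
    refine sum_congr rfl fun ρ _ => ?_
    split_ifs <;> simp
  have hR : ∑ σ ∈ lower κ, ∑ ρ ∈ upper σ, weight z z' ρ σ * h ρ =
      ∑ ρ ∈ levelFinset κ.card,
        (∑ σ ∈ lower κ, if Up σ ρ then weight z z' ρ σ else 0) * h ρ := by
    simp_rw [sum_mul]
    rw [sum_comm]
    refine sum_congr rfl fun σ hσ => ?_
    rw [(mem_lower.1 hσ).2, ← sum_levelFinset_ite_up_left rfl]
    refine sum_congr rfl fun ρ _ => ?_
    split_ifs <;> simp
  have hκ : κ ∈ levelFinset κ.card := mem_levelFinset.2 rfl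
  have hdiag : (∑ ν ∈ upper κ, if Up κ ν then weight z z' ν κ else 0) =
      (∑ σ ∈ lower κ, if Up σ κ then weight z z' κ σ else 0) +
        (z * z' + 2 * (κ.card : ℂ)) := by
    rw [sum_congr rfl fun ν hν => if_pos (mem_upper.1 hν),
      sum_congr rfl fun σ hσ => if_pos (mem_lower.1 hσ), sum_upper_weight]
  rw [hL, hR, ← add_sum_erase _ _ hκ, ← add_sum_erase _ _ hκ, hdiag]
  have hoff : ∀ ρ ∈ (levelFinset κ.card).erase κ,
      (∑ ν ∈ upper κ, if Up ρ ν then weight z z' ν κ else 0) * h ρ =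
      (∑ σ ∈ lower κ, if Up σ ρ then weight z z' ρ σ else 0) * h ρ := by
    intro ρ hρ
    rw [mem_erase, mem_levelFinset] at hρ
    rw [sum_upper_weight_eq_sum_lower_weight z z' hρ.2.symm hρ.1.symm]
  rw [sum_congr rfl hoff]
  ring

/-- Induction on |ν|: expand dim(μ,ρ) by the branching rule, commute the two operators and apply the
hypothesis below ν. With n = |ν| and m = |μ|, the scalars match by (n-m)(zz'+n-1+m) + (zz'+2n) =
(n+1-m)(zz'+n+m). -/
theorem sum_upper_weight_dimSkew (z z' : ℂ) {μ ν : YoungDiagram} (h : μ.card ≤ ν.card + 1) :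
    ∑ ρ ∈ upper ν, weight z z' ρ ν * (dimSkew μ ρ : ℂ) =
      ∑ κ ∈ lower μ, weight z z' μ κ * (dimSkew κ ν : ℂ) +
        ((ν.card : ℂ) + 1 - μ.card) * (z * z' + ν.card + μ.card) * (dimSkew μ ν : ℂ) := by
  classical
  induction hk : ν.card + 1 - μ.card generalizing ν with
  -- Here |μ| = |ν| + 1: the scalar term vanishes, and both sums reduce to the single weight of μ/ν
  -- if ν ↗ μ.
  | zero =>
    have hc : μ.card = ν.card + 1 := by omega
    have h1 : ∀ ρ ∈ upper ν, weight z z' ρ ν * (dimSkew μ ρ : ℂ) =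
        if ρ = μ then weight z z' μ ν else 0 := by
      intro ρ hρ
      have hρ2 := (mem_upper.1 hρ).2
      split_ifs with h
      · rw [h, dimSkew_self, Nat.cast_one, mul_one]
      · rw [dimSkew_of_card_le (by omega) (Ne.symm h), Nat.cast_zero, mul_zero]
    have h2 : ∀ κ ∈ lower μ, weight z z' μ κ * (dimSkew κ ν : ℂ) =
        if κ = ν then weight z z' μ ν else 0 := by
      intro κ hκ
      have hκ2 := (mem_lower.1 hκ).2
      split_ifs with h
      · rw [h, dimSkew_self, Nat.cast_one, mul_one]
      · rw [dimSkew_of_card_le (by omega) h, Nat.cast_zero, mul_zero]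
    rw [sum_congr rfl h1, sum_congr rfl h2, sum_ite_eq', sum_ite_eq', hc]
    simp only [mem_upper, mem_lower]
    push_cast
    ring
  | succ k ih =>
    have hL : ∀ ρ ∈ upper ν, weight z z' ρ ν * (dimSkew μ ρ : ℂ) =
        weight z z' ρ ν * ∑ σ ∈ lower ρ, (dimSkew μ σ : ℂ) := by
      intro ρ hρ
      have hρ2 := (mem_upper.1 hρ).2
      rw [dimSkew_eq_sum_lower (by omega), Nat.cast_sum]
    rw [sum_congr rfl hL, sum_upper_sum_lower]
    have hI : ∀ σ ∈ lower ν, ∑ ρ ∈ upper σ, weight z z' ρ σ * (dimSkew μ ρ : ℂ) =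
        ∑ κ ∈ lower μ, weight z z' μ κ * (dimSkew κ σ : ℂ) +
        ((ν.card : ℂ) - μ.card) * (z * z' + ν.card - 1 + μ.card) * (dimSkew μ σ : ℂ) := by
      intro σ hσ
      have hσ2 := (mem_lower.1 hσ).2
      rw [ih (by omega) (by omega), hσ2]
      push_cast
      ring
    rw [sum_congr rfl hI, sum_add_distrib, sum_comm, ← mul_sum]
    have hJ : ∀ κ ∈ lower μ, ∑ σ ∈ lower ν, weight z z' μ κ * (dimSkew κ σ : ℂ) =
        weight z z' μ κ * (dimSkew κ ν : ℂ) := by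
      intro κ hκ
      have hκ2 := (mem_lower.1 hκ).2
      rw [← mul_sum, dimSkew_eq_sum_lower (by omega : κ.card < ν.card), Nat.cast_sum]
    rw [sum_congr rfl hJ]
    -- The branching rule fails for |μ| = |ν|, but there the factor |ν| - |μ| is zero.
    have hlast : ((ν.card : ℂ) - μ.card) * ∑ σ ∈ lower ν, (dimSkew μ σ : ℂ) =
        ((ν.card : ℂ) - μ.card) * (dimSkew μ ν : ℂ) := by
      by_cases hc : μ.card = ν.card
      · rw [hc, sub_self, zero_mul, zero_mul]
      · rw [dimSkew_eq_sum_lower (by omega : μ.card < ν.card), Nat.cast_sum]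
    linear_combination (z * z' + ν.card - 1 + μ.card) * hlast

/-! ### The down and up operators on the functions `fsFun` -/

theorem downOp_apply {𝕜 : Type*} [Field 𝕜] (n : ℕ) (F : YoungDiagram → 𝕜) (ν : Level (n + 1)) :
    downOp n (fun κ => F κ.1) ν = (∑ κ ∈ lower ν.1, (dim κ : 𝕜) * F κ) / (dim ν.1 : 𝕜) := by
  classical
  rw [downOp, sum_level n (fun κ => pDown 𝕜 ν.1 κ * F κ), sum_div,
    ← sum_levelFinset_ite_up_right ν.2]
  refine sum_congr rfl fun κ _ => ?_
  rw [pDown]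
  split_ifs
  · ring
  · rw [zero_mul]

theorem downOp_fsFun {𝕜 : Type*} [Field 𝕜] [CharZero 𝕜] (μ : YoungDiagram) (n : ℕ)
    (ν : Level (n + 1)) :
    downOp n (fun κ => fsFun 𝕜 μ κ.1) ν =
      1 / ((n : 𝕜) + 1) * (((ν.1.card : 𝕜) - μ.card) * fsFun 𝕜 μ ν.1) := by
  obtain ⟨ν, hν⟩ := ν
  rw [downOp_apply]
  simp only
  have h1 : ∀ κ ∈ lower ν, (dim κ : 𝕜) * fsFun 𝕜 μ κ =
      (n.descFactorial μ.card : 𝕜) * (dimSkew μ κ : 𝕜) := by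
    intro κ hκ
    have hκ2 := (mem_lower.1 hκ).2
    have hd : (dim κ : 𝕜) ≠ 0 := by exact_mod_cast (dim_pos κ).ne'
    rw [fsFun, show κ.card = n by omega]
    field_simp
  rw [sum_congr rfl h1, ← mul_sum, fsFun, hν]
  have hn : (n : 𝕜) + 1 ≠ 0 := by exact_mod_cast Nat.succ_ne_zero n
  have hd : (dim ν : 𝕜) ≠ 0 := by exact_mod_cast (dim_pos ν).ne'
  by_cases hm : μ.card ≤ n
  · rw [dimSkew_eq_sum_lower (by omega : μ.card < ν.card)]
    have h2 : (n + 1 - μ.card) * (n + 1).descFactorial μ.card = (n + 1) * n.descFactorial μ.card := by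
      rw [← Nat.descFactorial_succ, Nat.succ_descFactorial_succ]
    have h3 : (((n + 1 : ℕ) : 𝕜) - μ.card) * ((n + 1).descFactorial μ.card : 𝕜) =
        ((n : 𝕜) + 1) * (n.descFactorial μ.card : 𝕜) := by
      rw [← Nat.cast_sub (by omega)]
      exact_mod_cast congrArg (Nat.cast (R := 𝕜)) h2
    rw [Nat.cast_sum]
    field_simp
    linear_combination (-∑ κ ∈ lower ν, (dimSkew μ κ : 𝕜)) * h3
  · rw [Nat.descFactorial_eq_zero_iff_lt.2 (not_le.1 hm)]
    -- At |μ| = n + 1 it is the factor |ν| - |μ| that vanishes on the right; beyond that, the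
    -- falling factorial does.
    by_cases hm1 : μ.card = n + 1
    · rw [hm1]
      simp
    · rw [Nat.descFactorial_eq_zero_iff_lt.2 (by omega : n + 1 < μ.card)]
      simp

theorem upOp_apply (z z' : ℂ) (n : ℕ) (F : YoungDiagram → ℂ) (κ : Level n) :
    upOp z z' n (fun ν => F ν.1) κ =
      1 / (z * z' + n) * ((∑ ν ∈ upper κ.1, weight z z' ν κ.1 * ((dim ν : ℂ) * F ν)) /
        (((n : ℂ) + 1) * (dim κ.1 : ℂ))) := by
  classical
  rw [upOp, sum_level (n + 1) (fun ν => pUp z z' κ.1 ν * F ν), sum_div, mul_sum,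
    ← sum_levelFinset_ite_up_left κ.2]
  refine sum_congr rfl fun ν _ => ?_
  rw [pUp, κ.2, weight]
  split_ifs
  · ring
  · rw [zero_mul]

theorem upOp_fsFun (z z' : ℂ) (μ : YoungDiagram) (n : ℕ) (ν : Level n) :
    upOp z z' n (fun ρ => fsFun ℂ μ ρ.1) ν =
      1 / (z * z' + n) * (∑ κ ∈ lower μ, weight z z' μ κ * fsFun ℂ κ ν.1 +
        ((ν.1.card : ℂ) + z * z' + μ.card) * fsFun ℂ μ ν.1) := by
  obtain ⟨ν, hν⟩ := ν
  rw [upOp_apply]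
  simp only
  congr 1
  have hd : (dim ν : ℂ) ≠ 0 := by exact_mod_cast (dim_pos ν).ne'
  have hn : (n : ℂ) + 1 ≠ 0 := by exact_mod_cast Nat.succ_ne_zero n
  have h1 : ∀ ρ ∈ upper ν, weight z z' ρ ν * ((dim ρ : ℂ) * fsFun ℂ μ ρ) =
      ((n + 1).descFactorial μ.card : ℂ) * (weight z z' ρ ν * (dimSkew μ ρ : ℂ)) := by
    intro ρ hρ
    have hρ2 := (mem_upper.1 hρ).2
    have hd : (dim ρ : ℂ) ≠ 0 := by exact_mod_cast (dim_pos ρ).ne'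
    rw [fsFun, show ρ.card = n + 1 by omega]
    field_simp
  rw [sum_congr rfl h1, ← mul_sum]
  rcases hm : μ.card with _ | m
  · have hl : lower μ = ∅ := by
      ext κ
      simp only [mem_lower, notMem_empty, iff_false]
      intro h
      have := h.2
      omega
    rw [sum_upper_weight_dimSkew z z' (by omega), hl, sum_empty, sum_empty, fsFun, hm, hν]
    simp only [Nat.descFactorial_zero, Nat.cast_one, Nat.cast_zero]
    field_simp
    ring
  · have h2 : ∀ κ ∈ lower μ, weight z z' μ κ * fsFun ℂ κ ν =
        (n.descFactorial m : ℂ) / (dim ν : ℂ) * (weight z z' μ κ * (dimSkew κ ν : ℂ)) := by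
      intro κ hκ
      have hκ2 := (mem_lower.1 hκ).2
      rw [fsFun, hν, show κ.card = m by omega]
      ring
    rw [sum_congr rfl h2, ← mul_sum]
    by_cases hmn : m ≤ n
    · rw [sum_upper_weight_dimSkew z z' (by omega), fsFun, hm, hν, Nat.succ_descFactorial_succ,
        Nat.descFactorial_succ]
      push_cast [Nat.cast_sub hmn]
      field_simp
      ring
    · rw [fsFun, hm, hν, Nat.descFactorial_eq_zero_iff_lt.2 (by omega : n + 1 < m + 1),
        Nat.descFactorial_eq_zero_iff_lt.2 (by omega : n < m),
        Nat.descFactorial_eq_zero_iff_lt.2 (by omega : n < m + 1)]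
      simp

section

/-! ### Power sums in terms of row lengths -/

theorem mem_diag_iff (ν : YoungDiagram) (i : ℕ) : (i, i) ∈ ν ↔ i < diagLen ν := by
  classical
  have hex : ∃ i, (i, i) ∉ ν :=
    ⟨ν.card, fun h => by
      have := fst_lt_card ((YoungDiagram.mem_cells _).2 h)
      simp only at this
      omega⟩
  have key : ∀ i, (i, i) ∈ ν ↔ i < Nat.find hex := by
    intro i
    constructor
    · intro h
      by_contra hc
      exact Nat.find_spec hex (ν.up_left_mem (not_lt.1 hc) (not_lt.1 hc) h)
    · intro h
      by_contra hc
      exact absurd (Nat.find_min' hex hc) (not_le.2 h)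
  have h2 : ν.cells.filter (fun c => c.1 = c.2) =
      (range (Nat.find hex)).image (fun i => (i, i)) := by
    ext ⟨i, j⟩
    simp only [mem_filter, YoungDiagram.mem_cells, mem_image, mem_range, Prod.mk.injEq]
    constructor
    · rintro ⟨h, rfl⟩
      exact ⟨i, (key i).1 h, rfl, rfl⟩
    · rintro ⟨a, ha, rfl, rfl⟩
      exact ⟨(key a).2 ha, rfl⟩
  rw [key, diagLen, h2, card_image_of_injective _ (fun a b hab => (Prod.mk.inj hab).1), card_range]

theorem sum_cells_arms {M : Type*} [AddCommMonoid M] (ν : YoungDiagram) (F : ℕ × ℕ → M) :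
    ∑ c ∈ ν.cells.filter (fun c => c.1 ≤ c.2), F c =
      ∑ i ∈ range (diagLen ν), ∑ t ∈ range (ν.rowLen i - i), F (i, i + t) := by
  rw [Finset.sum_sigma']
  refine sum_nbij' (fun c => ⟨c.1, c.2 - c.1⟩) (fun c => (c.1, c.1 + c.2)) ?_ ?_ ?_ ?_ ?_
  · rintro ⟨i, j⟩ h
    simp only [mem_filter, YoungDiagram.mem_cells] at h
    have h1 := YoungDiagram.mem_iff_lt_rowLen.1 h.1
    simp only [mem_sigma, mem_range]
    exact ⟨(mem_diag_iff ν i).1 (ν.up_left_mem le_rfl h.2 h.1), by omega⟩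
  · rintro ⟨i, t⟩ h
    simp only [mem_sigma, mem_range] at h
    simp only [mem_filter, YoungDiagram.mem_cells]
    exact ⟨YoungDiagram.mem_iff_lt_rowLen.2 (by omega), by omega⟩
  · rintro ⟨i, j⟩ h
    simp only [mem_filter] at h
    simp only [Prod.mk.injEq, true_and]
    omega
  · rintro ⟨i, t⟩ h
    simp
  · rintro ⟨i, j⟩ h
    simp only [mem_filter] at h
    simp only
    rw [Nat.add_sub_cancel' h.2]

theorem sum_cells_legs {M : Type*} [AddCommMonoid M] (ν : YoungDiagram) (F : ℕ × ℕ → M) :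
    ∑ c ∈ ν.cells.filter (fun c => ¬ c.1 ≤ c.2), F c =
      ∑ j ∈ range (diagLen ν), ∑ t ∈ range (ν.colLen j - (j + 1)), F (j + 1 + t, j) := by
  rw [Finset.sum_sigma']
  refine sum_nbij' (fun c => ⟨c.2, c.1 - (c.2 + 1)⟩) (fun c => (c.1 + 1 + c.2, c.1)) ?_ ?_ ?_ ?_ ?_
  · rintro ⟨i, j⟩ h
    simp only [mem_filter, YoungDiagram.mem_cells] at h
    have h1 := YoungDiagram.mem_iff_lt_colLen.1 h.1
    simp only [mem_sigma, mem_range]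
    exact ⟨(mem_diag_iff ν j).1 (ν.up_left_mem (by omega) le_rfl h.1), by omega⟩
  · rintro ⟨j, t⟩ h
    simp only [mem_sigma, mem_range] at h
    simp only [mem_filter, YoungDiagram.mem_cells]
    exact ⟨YoungDiagram.mem_iff_lt_colLen.2 (by omega), by omega⟩
  · rintro ⟨i, j⟩ h
    simp only [mem_filter] at h
    simp only [Prod.mk.injEq, and_true]
    omega
  · rintro ⟨i, t⟩ h
    simp
  · rintro ⟨i, j⟩ h
    simp only [mem_filter] at h
    simp only
    rw [Nat.add_sub_cancel' (by omega)]

variable {𝕜 : Type*} [Field 𝕜]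

theorem toFun_psum (k : ℕ+) (ν : YoungDiagram) :
    toFun 𝕜 (MvPolynomial.X k) ν = ∑ i ∈ range (diagLen ν), frobA 𝕜 ν i ^ (k : ℕ) +
      (-1) ^ ((k : ℕ) - 1) * ∑ i ∈ range (diagLen ν), frobB 𝕜 ν i ^ (k : ℕ) := by
  rw [toFun, MvPolynomial.aeval_X]

theorem toFun_apply (f : Sym 𝕜) (ν : YoungDiagram) :
    toFun 𝕜 f ν = MvPolynomial.eval (fun k => toFun 𝕜 (MvPolynomial.X k) ν) f := by
  have h : (Pi.evalAlgHom 𝕜 (fun _ : YoungDiagram => 𝕜) ν).comp (toFun 𝕜) =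
      MvPolynomial.aeval (fun k => toFun 𝕜 (MvPolynomial.X k) ν) := by
    ext k
    simp
  have h2 := DFunLike.congr_fun h f
  rw [MvPolynomial.aeval_eq_eval] at h2
  exact h2

theorem toFun_C (a : 𝕜) (ν : YoungDiagram) : toFun 𝕜 (MvPolynomial.C a) ν = a := by
  rw [toFun_apply, MvPolynomial.eval_C]

/-- Sum (c+1/2)^k - (c-1/2)^k over the contents c of all boxes. Along rows the sum telescopes to the
right side. Along diagonal hooks the arm, diagonal box included, gives a^k - (-1/2)^k and the leg
gives (-1/2)^k - (-b)^k, which add up to the Frobenius form. -/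
theorem toFun_psum_eq_sum_rows [CharZero 𝕜] (k : ℕ+) {ν : YoungDiagram} {N : ℕ}
    (hN : ν.rowLen N = 0) :
    toFun 𝕜 (MvPolynomial.X k) ν = ∑ r ∈ range N,
      (((ν.rowLen r : 𝕜) - r - 1 / 2) ^ (k : ℕ) - (-(r : 𝕜) - 1 / 2) ^ (k : ℕ)) := by
  set F : ℕ × ℕ → 𝕜 := fun c =>
    ((c.2 : 𝕜) - c.1 + 1 / 2) ^ (k : ℕ) - ((c.2 : 𝕜) - c.1 - 1 / 2) ^ (k : ℕ) with hF
  have hrows : ∑ c ∈ ν.cells, F c = ∑ r ∈ range N,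
      (((ν.rowLen r : 𝕜) - r - 1 / 2) ^ (k : ℕ) - (-(r : 𝕜) - 1 / 2) ^ (k : ℕ)) := by
    rw [sum_cells hN]
    refine sum_congr rfl fun r _ => ?_
    have h := sum_range_sub (fun j : ℕ => ((j : 𝕜) - r - 1 / 2) ^ (k : ℕ)) (ν.rowLen r)
    simp only [Nat.cast_zero, zero_sub] at h
    rw [← h]
    refine sum_congr rfl fun j _ => ?_
    simp only [hF]
    push_cast
    ring_nf
  rw [← hrows, ← sum_filter_add_sum_filter_not _ (fun c => c.1 ≤ c.2), sum_cells_arms,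
    sum_cells_legs, toFun_psum, mul_sum, ← sum_add_distrib, ← sum_add_distrib]
  refine sum_congr rfl fun i hi => ?_
  have hd := (mem_diag_iff ν i).2 (mem_range.1 hi)
  have hr := YoungDiagram.mem_iff_lt_rowLen.1 hd
  have hc := YoungDiagram.mem_iff_lt_colLen.1 hd
  have harm : ∑ t ∈ range (ν.rowLen i - i), F (i, i + t) =
      frobA 𝕜 ν i ^ (k : ℕ) - (-(1 / 2)) ^ (k : ℕ) := by
    have h := sum_range_sub (fun j : ℕ => ((j : 𝕜) - 1 / 2) ^ (k : ℕ)) (ν.rowLen i - i)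
    simp only [Nat.cast_zero, zero_sub, Nat.cast_sub hr.le] at h
    have h3 : frobA 𝕜 ν i = (ν.rowLen i : 𝕜) - i - 1 / 2 := by rw [frobA]; ring
    rw [h3, ← h]
    refine sum_congr rfl fun j _ => ?_
    simp only [hF]
    push_cast
    ring_nf
  have hleg : ∑ t ∈ range (ν.colLen i - (i + 1)), F (i + 1 + t, i) =
      (-(1 / 2)) ^ (k : ℕ) - (- frobB 𝕜 ν i) ^ (k : ℕ) := by
    have h := sum_range_sub' (fun j : ℕ => (-(j : 𝕜) - 1 / 2) ^ (k : ℕ)) (ν.colLen i - (i + 1))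
    simp only [Nat.cast_zero, neg_zero, zero_sub, Nat.cast_sub (Nat.succ_le_of_lt hc)] at h
    have h3 : - frobB 𝕜 ν i = -((ν.colLen i : 𝕜) - ((i + 1 : ℕ) : 𝕜)) - 1 / 2 := by
      rw [frobB]; push_cast; ring
    rw [h3, ← h]
    refine sum_congr rfl fun j _ => ?_
    simp only [hF]
    push_cast
    ring_nf
  rw [harm, hleg]
  obtain ⟨m, hm⟩ : ∃ m, (k : ℕ) = m + 1 := ⟨k - 1, by have := k.pos; omega⟩
  rw [hm, Nat.add_sub_cancel, neg_pow (frobB 𝕜 ν i)]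
  ring

/-- The coordinate `p_k` in terms of shifted row lengths, up to an additive constant. -/
theorem toFun_psum_eq_sum_beta [CharZero 𝕜] (k : ℕ+) {ν : YoungDiagram} {N : ℕ}
    (hN : ν.rowLen N = 0) :
    toFun 𝕜 (MvPolynomial.X k) ν = ∑ r : Fin N, ((beta N ν r : 𝕜) - (N - 1 / 2)) ^ (k : ℕ) -
      ∑ r ∈ range N, (-(r : 𝕜) - 1 / 2) ^ (k : ℕ) := by
  rw [toFun_psum_eq_sum_rows k hN, sum_sub_distrib, ← Fin.sum_univ_eq_sum_range
    (fun r => ((ν.rowLen r : 𝕜) - r - 1 / 2) ^ (k : ℕ))]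
  congr 1
  refine sum_congr rfl fun r _ => ?_
  congr 1
  have := r.2
  rw [beta, show N - 1 - (r : ℕ) = N - (r + 1) by omega]
  push_cast [Nat.cast_sub (show (r : ℕ) + 1 ≤ N by omega)]
  ring

theorem toFun_psum_one [CharZero 𝕜] (ν : YoungDiagram) :
    toFun 𝕜 (psum 𝕜 1) ν = ν.card := by
  have hN : ν.rowLen ν.card = 0 := rowLen_eq_zero_of_card_le le_rfl
  rw [psum, toFun_psum_eq_sum_rows 1 hN]
  nth_rewrite 2 [card_eq_sum_rowLen hN]
  rw [Nat.cast_sum]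
  refine sum_congr rfl fun r _ => ?_
  rw [PNat.one_coe, pow_one, pow_one]
  ring

end

section

/-! ### Complex numbers with prescribed power sums -/

/-- The x i are the roots, with multiplicity, of the monic polynomial whose coefficients are the
prescribed values up to sign. -/
theorem exists_esymm_eq (N : ℕ) (e : ℕ → ℂ) (h0 : e 0 = 1) :
    ∃ x : Fin N → ℂ, ∀ k ≤ N, MvPolynomial.aeval x (MvPolynomial.esymm (Fin N) ℂ k) = e k := by
  set q : Polynomial ℂ := Polynomial.X ^ N +
    ∑ i : Fin N, Polynomial.C ((-1) ^ (N - (i : ℕ)) * e (N - i)) * Polynomial.X ^ (i : ℕ) with hq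
  have hdeg : (∑ i : Fin N, Polynomial.C ((-1) ^ (N - (i : ℕ)) * e (N - i)) *
      Polynomial.X ^ (i : ℕ)).degree < (N : WithBot ℕ) :=
    Polynomial.degree_sum_fin_lt (fun i : Fin N => (-1) ^ (N - (i : ℕ)) * e (N - i))
  have hmonic : q.Monic := Polynomial.monic_X_pow_add hdeg
  have hnat : q.natDegree = N := by
    refine Polynomial.natDegree_eq_of_degree_eq_some ?_
    rw [hq, Polynomial.degree_add_eq_left_of_degree_lt, Polynomial.degree_X_pow]
    rwa [Polynomial.degree_X_pow]
  have hcoeff : ∀ i < N, q.coeff i = (-1) ^ (N - i) * e (N - i) := by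
    intro i hi
    rw [hq, Polynomial.coeff_add, Polynomial.coeff_X_pow, if_neg hi.ne, zero_add,
      Polynomial.finsetSum_coeff, sum_eq_single ⟨i, hi⟩]
    · rw [Polynomial.coeff_C_mul, Polynomial.coeff_X_pow, if_pos rfl, mul_one]
    · intro j _ hj
      rw [Polynomial.coeff_C_mul, Polynomial.coeff_X_pow, if_neg, mul_zero]
      exact fun h => hj (Fin.ext h.symm)
    · simp
  have hsplit : q.Splits := IsAlgClosed.splits q
  have hcard : q.roots.toList.length = N := by
    rw [Multiset.length_toList, ← Polynomial.splits_iff_card_roots.1 hsplit |>.symm, hnat]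
  refine ⟨fun i => q.roots.toList.get (Fin.cast hcard.symm i), fun k hk => ?_⟩
  have hmap : univ.val.map (fun i : Fin N => q.roots.toList.get (Fin.cast hcard.symm i)) =
      q.roots := by
    rw [Fin.univ_val_map]
    have : List.ofFn (fun i : Fin N => q.roots.toList.get (Fin.cast hcard.symm i)) =
        q.roots.toList := by
      refine List.ext_get (by simp [hcard]) fun n h1 h2 => ?_
      simp
    rw [this, Multiset.coe_toList]
  rw [MvPolynomial.aeval_esymm_eq_multiset_esymm, hmap]
  rcases Nat.eq_zero_or_pos k with rfl | hpos
  · rw [h0]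
    simp [Multiset.esymm]
  · have h1 := Polynomial.coeff_eq_esymm_roots_of_splits hsplit (k := N - k) (by omega)
    rw [hcoeff _ (by omega), hmonic.leadingCoeff, hnat, one_mul, Nat.sub_sub_self hk] at h1
    exact (mul_left_cancel₀ (pow_ne_zero _ (by norm_num)) h1).symm

theorem exists_newton_sequence (t : ℕ → ℂ) (n : ℕ) :
    ∃ e : ℕ → ℂ, e 0 = 1 ∧ ∀ k ≤ n, (k : ℂ) * e k = (-1) ^ (k + 1) *
      ∑ a ∈ antidiagonal k with a.1 < k, (-1) ^ a.1 * e a.1 * t a.2 := by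
  induction n with
  | zero =>
    refine ⟨fun _ => 1, rfl, fun k hk => ?_⟩
    obtain rfl := Nat.le_zero.1 hk
    simp
  | succ n ih =>
    obtain ⟨e, he0, he⟩ := ih
    refine ⟨Function.update e (n + 1) ((-1) ^ (n + 1 + 1) / ((n + 1 : ℕ) : ℂ) *
      ∑ a ∈ antidiagonal (n + 1) with a.1 < n + 1, (-1) ^ a.1 * e a.1 * t a.2), ?_, ?_⟩
    · rw [Function.update_of_ne (by omega), he0]
    · intro k hk
      have hsum : ∀ v : ℂ, ∑ a ∈ antidiagonal k with a.1 < k,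
          (-1) ^ a.1 * Function.update e (n + 1) v a.1 * t a.2 =
          ∑ a ∈ antidiagonal k with a.1 < k, (-1) ^ a.1 * e a.1 * t a.2 := by
        intro v
        refine sum_congr rfl fun a ha => ?_
        have := (mem_filter.1 ha).2
        rw [Function.update_of_ne (by omega)]
      rw [hsum]
      by_cases hkn : k = n + 1
      · subst hkn
        rw [Function.update_self]
        have : ((n + 1 : ℕ) : ℂ) ≠ 0 := by exact_mod_cast Nat.succ_ne_zero n
        field_simp
      · rw [Function.update_of_ne hkn, he k (by omega)]

/-- Newton's identities turn prescribed power sums into prescribed elementary symmetric values,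
which are realised by roots over ℂ; the same identities, read back inductively, recover the power
sums. -/
theorem exists_sum_pow_eq (N : ℕ) (t : ℕ → ℂ) :
    ∃ x : Fin N → ℂ, ∀ k, 0 < k → k ≤ N → ∑ i, x i ^ k = t k := by
  obtain ⟨e, he0, he⟩ := exists_newton_sequence t N
  obtain ⟨x, hx⟩ := exists_esymm_eq N e he0
  refine ⟨x, fun k => ?_⟩
  induction k using Nat.strong_induction_on with
  | _ k ih =>
    intro hk hkN
    have h1 := congrArg (MvPolynomial.aeval x) (MvPolynomial.mul_esymm_eq_sum (Fin N) ℂ k)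
    simp only [map_mul, map_natCast, map_pow, map_neg, map_one, map_sum, hx k hkN] at h1
    rw [he k hkN] at h1
    have h2 := mul_left_cancel₀ (pow_ne_zero _ (by norm_num)) h1
    have h0 : ((0, k) : ℕ × ℕ) ∈ (antidiagonal k).filter (fun a => a.1 < k) := by
      simp [hk]
    rw [← add_sum_erase _ _ h0, ← add_sum_erase _ _ h0] at h2
    have h3 : ∀ a ∈ ((antidiagonal k).filter (fun a => a.1 < k)).erase (0, k),
        (-1 : ℂ) ^ a.1 * e a.1 * t a.2 = (-1 : ℂ) ^ a.1 *
          MvPolynomial.aeval x (MvPolynomial.esymm (Fin N) ℂ a.1) *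
          MvPolynomial.aeval x (MvPolynomial.psum (Fin N) ℂ a.2) := by
      rintro ⟨a, b⟩ hab
      simp only [mem_erase, mem_filter, HasAntidiagonal.mem_antidiagonal, ne_eq, Prod.mk.injEq] at hab
      have ha : a ≠ 0 := fun h => hab.1 ⟨h, by omega⟩
      have h4 := ih b (by omega) (by omega) (by omega)
      simp only
      rw [hx a (by omega), ← h4]
      simp [MvPolynomial.psum]
    rw [sum_congr rfl h3] at h2
    have h5 := add_right_cancel h2
    simp [MvPolynomial.psum] at h5
    rw [← h5, he0, one_mul]

/-! ### Diagrams with prescribed shifted row lengths -/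

theorem add_le_of_strictAnti {N : ℕ} {l : Fin N → ℕ} (hl : StrictAnti l) {r : ℕ} (d : ℕ)
    (h : r + d < N) : l ⟨r + d, h⟩ + d ≤ l ⟨r, by omega⟩ := by
  induction d with
  | zero => exact le_rfl
  | succ d ih =>
    have h1 := ih (by omega)
    have h2 : l ⟨r + (d + 1), h⟩ < l ⟨r + d, by omega⟩ := hl (Fin.mk_lt_mk.2 (by omega))
    omega

theorem exists_beta_eq {N : ℕ} {l : Fin N → ℕ} (hl : StrictAnti l) :
    ∃ ν : YoungDiagram, ν.rowLen N = 0 ∧ beta N ν = l := by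
  have hshift : ∀ r s : Fin N, r ≤ s → l s + (s - r : ℕ) ≤ l r := by
    intro r s hrs
    have hrs' : (r : ℕ) ≤ s := hrs
    have hs := s.2
    have := add_le_of_strictAnti hl (r := r) (s - r) (by omega)
    have h2 : (⟨(r : ℕ) + (s - r), by omega⟩ : Fin N) = s := Fin.ext (by simp; omega)
    rw [h2] at this
    exact this
  -- Subtracting the staircase N-1, …, 0 leaves weakly decreasing row lengths; `hshift` ensures that
  -- the truncated subtraction loses nothing.
  set w : List ℕ := List.ofFn (fun r : Fin N => l r - (N - 1 - r)) with hw
  have hsort : w.SortedGE := by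
    rw [hw, List.sortedGE_ofFn_iff]
    intro r s hrs
    have h1 := hshift r s hrs
    have hrs' : (r : ℕ) ≤ s := hrs
    have := s.2
    simp only
    omega
  have hlen : w.length = N := by simp [hw]
  refine ⟨YoungDiagram.ofRowLens w hsort, ?_, ?_⟩
  · refine rowLen_eq_of_forall_mem_iff fun j => ?_
    rw [YoungDiagram.mem_ofRowLens]
    simp [hlen]
  · ext r
    have hr := r.2
    have h1 := YoungDiagram.rowLen_ofRowLens (hw := hsort) (Fin.cast hlen.symm r)
    rw [beta]
    simp only [Fin.val_cast] at h1
    rw [h1]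
    have h2 := hshift r ⟨N - 1, by omega⟩ (Fin.mk_le_mk.2 (by omega))
    simp only at h2
    simp [hw]
    omega

theorem exists_perm_strictAnti {N : ℕ} {l : Fin N → ℕ} (hl : Function.Injective l) :
    ∃ σ : Equiv.Perm (Fin N), StrictAnti (l ∘ σ) := by
  refine ⟨Fin.revPerm.trans (Tuple.sort l), ?_⟩
  have h : StrictMono (l ∘ Tuple.sort l) :=
    (Tuple.monotone_sort l).strictMono_of_injective (hl.comp (Tuple.sort l).injective)
  intro i j hij
  exact h (Fin.rev_lt_rev.2 hij)

/-! ### Injectivity -/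

/-- Let N bound the indices of the p_k in F. Substituting shifted power sums in N variables gives a
symmetric polynomial G whose values at distinct natural numbers are values of F on diagrams, hence
zero. So G = 0, and since N complex numbers can have any first N power sums, F vanishes at every
point. -/
theorem toFun_complex_injective : Function.Injective (toFun ℂ) := by
  rw [injective_iff_map_eq_zero]
  intro F hF
  set N : ℕ := F.vars.sup (fun k : ℕ+ => (k : ℕ)) with hN
  set c : ℕ+ → ℂ := fun k => ∑ r ∈ range N, (-(r : ℂ) - 1 / 2) ^ (k : ℕ) with hc
  set G : MvPolynomial (Fin N) ℂ := MvPolynomial.aeval (fun k : ℕ+ =>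
    ∑ r : Fin N, (MvPolynomial.X r - MvPolynomial.C ((N : ℂ) - 1 / 2)) ^ (k : ℕ) -
      MvPolynomial.C (c k)) F with hG
  have hGe : ∀ x : Fin N → ℂ, MvPolynomial.eval x G =
      MvPolynomial.eval (fun k : ℕ+ => ∑ r : Fin N, (x r - ((N : ℂ) - 1 / 2)) ^ (k : ℕ) - c k) F := by
    intro x
    have h : (MvPolynomial.aeval x).comp (MvPolynomial.aeval (R := ℂ) (fun k : ℕ+ =>
        ∑ r : Fin N, (MvPolynomial.X r - MvPolynomial.C ((N : ℂ) - 1 / 2)) ^ (k : ℕ) -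
          MvPolynomial.C (c k))) = MvPolynomial.aeval (fun k : ℕ+ =>
        ∑ r : Fin N, (x r - ((N : ℂ) - 1 / 2)) ^ (k : ℕ) - c k) := by
      ext k
      simp
    have h2 := DFunLike.congr_fun h F
    rw [MvPolynomial.aeval_eq_eval] at h2
    exact h2
  -- This factor vanishes at points with a repeated coordinate, so G * V vanishes on all of ℕ^N,
  -- which is Zariski dense.
  set V : MvPolynomial (Fin N) ℂ :=
    ∏ i, ∏ j ∈ univ.erase i, (MvPolynomial.X i - MvPolynomial.X j) with hV
  have hV0 : V ≠ 0 := by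
    refine prod_ne_zero_iff.2 fun i _ => prod_ne_zero_iff.2 fun j hj => ?_
    rw [sub_ne_zero]
    exact fun h => (ne_of_mem_erase hj).symm (MvPolynomial.X_injective h)
  have hGV : G * V = 0 := by
    refine MvPolynomial.funext_set (fun _ => Set.range (Nat.cast : ℕ → ℂ))
      (fun _ => Set.infinite_range_of_injective Nat.cast_injective) fun x hx => ?_
    choose l hl using fun i => hx i (Set.mem_univ i)
    rw [map_mul, map_zero]
    by_cases hinj : Function.Injective l
    · obtain ⟨σ, hσ⟩ := exists_perm_strictAnti hinj
      obtain ⟨ν, hν, hβ⟩ := exists_beta_eq hσ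
      have h1 : MvPolynomial.eval x G = toFun ℂ F ν := by
        rw [hGe, toFun_apply]
        congr 2
        funext k
        rw [toFun_psum_eq_sum_beta k hν, hβ, ← Equiv.sum_comp σ]
        simp [hl, hc]
      rw [h1, hF, Pi.zero_apply, zero_mul]
    · obtain ⟨i, j, hij, hne⟩ : ∃ i j, l i = l j ∧ i ≠ j := by
        simpa [Function.Injective] using hinj
      rw [hV, map_prod, prod_eq_zero (mem_univ i), mul_zero]
      rw [map_prod, prod_eq_zero (mem_erase.2 ⟨hne.symm, mem_univ j⟩)]
      rw [map_sub, MvPolynomial.eval_X, MvPolynomial.eval_X, ← hl, ← hl, hij, sub_self]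
  have hG0 : G = 0 := (mul_eq_zero.1 hGV).resolve_right hV0
  refine MvPolynomial.funext fun t => ?_
  -- The constants c k and the shift by N - 1/2 undo the substitution that defines G.
  obtain ⟨y, hy⟩ := exists_sum_pow_eq N
    (fun k => t k.toPNat' + c k.toPNat')
  have h1 := hGe (fun r => y r + ((N : ℂ) - 1 / 2))
  rw [hG0, map_zero] at h1
  rw [map_zero, h1]
  refine MvPolynomial.eval₂Hom_congr' rfl (fun k hk _ => ?_) rfl
  have hkN : (k : ℕ) ≤ N := le_sup (f := fun k : ℕ+ => (k : ℕ)) hk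
  rw [sum_congr rfl fun r _ => by rw [add_sub_cancel_right], hy k k.pos hkN, PNat.coe_toPNat',
    add_sub_cancel_right]

/-! ### Passage from ℂ to the base field -/

variable {𝕜 : Type*} [Field 𝕜] [Algebra 𝕜 ℂ]

theorem charZero_of_algebra_complex (𝕜 : Type*) [Field 𝕜] [Algebra 𝕜 ℂ] : CharZero 𝕜 :=
  (algebraMap 𝕜 ℂ).charZero

theorem algebraMap_toFun_psum (k : ℕ+) (ν : YoungDiagram) :
    algebraMap 𝕜 ℂ (toFun 𝕜 (MvPolynomial.X k) ν) = toFun ℂ (MvPolynomial.X k) ν := by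
  have := charZero_of_algebra_complex 𝕜
  have hN : ν.rowLen ν.card = 0 := rowLen_eq_zero_of_card_le le_rfl
  have h2 : algebraMap 𝕜 ℂ 2 = 2 := map_ofNat _ 2
  rw [toFun_psum_eq_sum_rows k hN, toFun_psum_eq_sum_rows k hN]
  simp [h2]

theorem toFun_complexify (f : Sym 𝕜) (ν : YoungDiagram) :
    toFun ℂ (complexify f) ν = algebraMap 𝕜 ℂ (toFun 𝕜 f ν) := by
  rw [toFun_apply, toFun_apply f, complexify, MvPolynomial.eval_map]
  refine Eq.trans ?_ (MvPolynomial.eval₂_comp_left (algebraMap 𝕜 ℂ) (RingHom.id 𝕜) _ f).symm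
  rw [RingHom.comp_id]
  congr 1
  funext k
  exact (algebraMap_toFun_psum k ν).symm

theorem toFun_injective (𝕜 : Type*) [Field 𝕜] [Algebra 𝕜 ℂ] : Function.Injective (toFun 𝕜) := by
  intro f g h
  refine MvPolynomial.map_injective (algebraMap 𝕜 ℂ) (algebraMap 𝕜 ℂ).injective
    (toFun_complex_injective (funext fun ν => ?_))
  have := toFun_complexify f ν
  rw [h, ← toFun_complexify] at this
  exact this

end

section

/-! ### Multiplication of alternants by power sums -/

section Alternants

variable {𝕜 : Type*} [Field 𝕜]

variable (𝕜) in
/-- The span of the alternants of total exponent at most `m`. -/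
def altSpan (N m : ℕ) : Submodule 𝕜 ((Fin N → ℕ) → 𝕜) :=
  Submodule.span 𝕜 {F | ∃ e : Fin N → ℕ, ∑ i, e i ≤ m ∧ F = alt 𝕜 e}

theorem alt_mem_altSpan {N m : ℕ} {e : Fin N → ℕ} (h : ∑ i, e i ≤ m) :
    alt 𝕜 e ∈ altSpan 𝕜 N m :=
  Submodule.subset_span ⟨e, h, rfl⟩

theorem altSpan_mono (N : ℕ) {m m' : ℕ} (h : m ≤ m') : altSpan 𝕜 N m ≤ altSpan 𝕜 N m' :=
  Submodule.span_mono fun _ ⟨e, he, hF⟩ => ⟨e, he.trans h, hF⟩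

variable (𝕜) in
/-- The span of the falling factorials of degrees `e, …, e + k`. -/
def fallingSpan (e k : ℕ) : Submodule 𝕜 (ℕ → 𝕜) :=
  Submodule.span 𝕜 {w | ∃ t ≤ k, w = fun l => (l.descFactorial (e + t) : 𝕜)}

/-- Multiplying a falling factorial of degree j by l gives the one of degree j + 1 plus j times
itself. -/
theorem sub_mul_mem_fallingSpan (a : 𝕜) {e k : ℕ} {w : ℕ → 𝕜} (hw : w ∈ fallingSpan 𝕜 e k) :
    (fun l : ℕ => ((l : 𝕜) - a) * w l) ∈ fallingSpan 𝕜 e (k + 1) := by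
  induction hw using Submodule.span_induction with
  | mem w hw =>
    obtain ⟨t, ht, rfl⟩ := hw
    have h : (fun l : ℕ => ((l : 𝕜) - a) * (l.descFactorial (e + t) : 𝕜)) =
        (fun l : ℕ => (l.descFactorial (e + (t + 1)) : 𝕜)) +
          (((e + t : ℕ) : 𝕜) - a) • (fun l : ℕ => (l.descFactorial (e + t) : 𝕜)) := by
      funext l
      simp only [Pi.add_apply, Pi.smul_apply, smul_eq_mul]
      rw [← add_assoc, Nat.descFactorial_succ]
      by_cases h : e + t ≤ l
      · push_cast [Nat.cast_sub h]
        ring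
      · rw [Nat.descFactorial_eq_zero_iff_lt.2 (not_le.1 h)]
        simp
    rw [h]
    exact Submodule.add_mem _ (Submodule.subset_span ⟨t + 1, by omega, rfl⟩)
      (Submodule.smul_mem _ _ (Submodule.subset_span ⟨t, by omega, rfl⟩))
  | zero =>
    convert! Submodule.zero_mem (fallingSpan 𝕜 e (k + 1)) using 1
    funext l
    simp
  | add u v _ _ hu hv =>
    convert! Submodule.add_mem _ hu hv using 1
    funext l
    simp only [Pi.add_apply]
    ring
  | smul c u _ hu =>
    convert! Submodule.smul_mem _ c hu using 1
    funext l
    simp only [Pi.smul_apply, smul_eq_mul]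
    ring

theorem pow_mul_mem_fallingSpan (a : 𝕜) (e k : ℕ) :
    (fun l : ℕ => ((l : 𝕜) - a) ^ k * (l.descFactorial e : 𝕜)) ∈ fallingSpan 𝕜 e k := by
  induction k with
  | zero => exact Submodule.subset_span ⟨0, le_rfl, by simp⟩
  | succ k ih =>
    convert! sub_mul_mem_fallingSpan a ih using 1
    funext l
    ring

theorem det_updateCol_mem_altSpan {N m k : ℕ} {e : Fin N → ℕ} (he : ∑ i, e i ≤ m) (s : Fin N)
    {w : ℕ → 𝕜} (hw : w ∈ fallingSpan 𝕜 (e s) k) :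
    (fun l : Fin N → ℕ => ((Matrix.of fun r s => ((l r).descFactorial (e s) : 𝕜)).updateCol s
      (fun r => w (l r))).det) ∈ altSpan 𝕜 N (m + k) := by
  induction hw using Submodule.span_induction with
  | mem w hw =>
    obtain ⟨t, ht, rfl⟩ := hw
    have h : (fun l : Fin N → ℕ =>
        ((Matrix.of fun r s => ((l r).descFactorial (e s) : 𝕜)).updateCol s
          (fun r => ((l r).descFactorial (e s + t) : 𝕜))).det) =
        alt 𝕜 (Function.update e s (e s + t)) := by
      funext l
      rw [alt]
      congr 1
      ext r s'
      by_cases hs : s' = s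
      · subst hs
        simp
      · simp [hs]
    rw [h]
    refine alt_mem_altSpan ?_
    rw [sum_update_of_mem (mem_univ s)]
    have h2 := add_sum_erase univ e (mem_univ s)
    rw [sdiff_singleton_eq_erase]
    omega
  | zero =>
    convert! Submodule.zero_mem (altSpan 𝕜 N (m + k)) using 1
    funext l
    exact Matrix.det_eq_zero_of_column_eq_zero s fun r => by simp
  | add u v _ _ hu hv =>
    convert! Submodule.add_mem _ hu hv using 1
    funext l
    exact Matrix.det_updateCol_add _ s (fun r => u (l r)) (fun r => v (l r))
  | smul c u _ hu =>
    convert! Submodule.smul_mem _ c hu using 1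
    funext l
    exact Matrix.det_updateCol_smul _ s c (fun r => u (l r))

/-- By `sum_det_updateCol_mul`, the power sum may be distributed over the columns; each scaled
column is a combination of falling factorials whose degrees exceed e s by at most k, and the
determinant is linear in that column. -/
theorem sum_pow_mul_mem_altSpan {N m : ℕ} (a : 𝕜) (k : ℕ) {F : (Fin N → ℕ) → 𝕜}
    (hF : F ∈ altSpan 𝕜 N m) :
    (fun l => (∑ r, ((l r : 𝕜) - a) ^ k) * F l) ∈ altSpan 𝕜 N (m + k) := by
  induction hF using Submodule.span_induction with
  | mem F hF =>
    obtain ⟨e, he, rfl⟩ := hF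
    have h : (fun l : Fin N → ℕ => (∑ r, ((l r : 𝕜) - a) ^ k) * alt 𝕜 e l) =
        ∑ s, (fun l : Fin N → ℕ =>
          ((Matrix.of fun r s => ((l r).descFactorial (e s) : 𝕜)).updateCol s
          (fun r => ((l r : 𝕜) - a) ^ k * ((l r).descFactorial (e s) : 𝕜))).det) := by
      funext l
      rw [Finset.sum_apply, alt, ← sum_det_updateCol_mul]
      rfl
    rw [h]
    exact Submodule.sum_mem _ fun s _ =>
      det_updateCol_mem_altSpan he s (pow_mul_mem_fallingSpan a (e s) k)
  | zero =>
    convert! Submodule.zero_mem (altSpan 𝕜 N (m + k)) using 1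
    funext l
    simp
  | add u v _ _ hu hv =>
    convert! Submodule.add_mem _ hu hv using 1
    funext l
    simp only [Pi.add_apply]
    ring
  | smul c u _ hu =>
    convert! Submodule.smul_mem _ c hu using 1
    funext l
    simp only [Pi.smul_apply, smul_eq_mul]
    ring

/-- The weighted degree of a monomial, where `p_k` has degree `k`. -/
noncomputable def wt : (ℕ+ →₀ ℕ) →+ ℕ := Finsupp.weight (fun k : ℕ+ => (k : ℕ))

theorem wt_single (k : ℕ+) (n : ℕ) : wt (Finsupp.single k n) = n * k := by
  rw [wt, Finsupp.weight_single, smul_eq_mul]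

theorem monomial_mul_mem_altSpan {N : ℕ} (a : 𝕜) (c : ℕ+ → 𝕜) (s : ℕ+ →₀ ℕ) {m : ℕ}
    {F : (Fin N → ℕ) → 𝕜} (hF : F ∈ altSpan 𝕜 N m) :
    (fun l => (s.prod fun k n => (∑ r, ((l r : 𝕜) - a) ^ (k : ℕ) - c k) ^ n) * F l) ∈
      altSpan 𝕜 N (m + wt s) := by
  induction s using Finsupp.induction_linear generalizing m F with
  | zero => simpa using hF
  | add s t hs ht =>
    have h := hs (ht hF)
    rw [map_add, show m + (wt s + wt t) = m + wt t + wt s by ring]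
    convert! h using 1
    funext l
    rw [Finsupp.prod_add_index' (by simp) (by intros; rw [pow_add]), mul_assoc]
  | single k n =>
    rw [wt_single]
    simp only [Finsupp.prod_single_index, pow_zero]
    induction n with
    | zero => simpa using hF
    | succ n ih =>
      have h1 := sum_pow_mul_mem_altSpan a (k : ℕ) ih
      have h2 := Submodule.smul_mem _ (c k) (altSpan_mono N (Nat.le_add_right _ (k : ℕ)) ih)
      rw [show m + (n + 1) * (k : ℕ) = m + n * k + k by ring]
      convert! Submodule.sub_mem _ h1 h2 using 1
      funext l
      simp only [Pi.sub_apply, Pi.smul_apply, smul_eq_mul]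
      ring

end Alternants

/-! ### The span of the functions `fsFun` -/

variable {𝕜 : Type*} [Field 𝕜]

variable (𝕜) in
/-- The span of the functions `fsFun μ` with `|μ| ≤ m`. -/
def fsSpan (m : ℕ) : Submodule 𝕜 (YoungDiagram → 𝕜) :=
  Submodule.span 𝕜 (fsFun 𝕜 '' {μ | μ.card ≤ m})

theorem fsFun_of_card_le {μ ν : YoungDiagram} (h : ν.card ≤ μ.card) (hne : μ ≠ ν) :
    fsFun 𝕜 μ ν = 0 := by
  rw [fsFun, dimSkew_of_card_le h hne, Nat.cast_zero, zero_div, mul_zero]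

theorem fsFun_self_ne_zero [CharZero 𝕜] (μ : YoungDiagram) : fsFun 𝕜 μ μ ≠ 0 := by
  rw [fsFun, dimSkew_self, Nat.descFactorial_self, Nat.cast_one]
  refine mul_ne_zero ?_ (one_div_ne_zero ?_)
  · exact_mod_cast Nat.factorial_ne_zero _
  · exact_mod_cast (dim_pos μ).ne'

/-- Evaluate at a diagram ν of least size in the support: every other `fsFun 𝕜 μ` occurring vanishes
at ν, while `fsFun 𝕜 ν` does not. Only values on the support enter, which `eq_zero_of_mem_fsSpan`
needs. -/
theorem eq_zero_of_linearCombination_fsFun [CharZero 𝕜] (a : YoungDiagram →₀ 𝕜)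
    (h : ∀ ν ∈ a.support, Finsupp.linearCombination 𝕜 (fsFun 𝕜) a ν = 0) : a = 0 := by
  by_contra h0
  obtain ⟨ν, hν, hmin⟩ := exists_min_image a.support YoungDiagram.card
    (Finsupp.support_nonempty_iff.2 h0)
  have h1 := h ν hν
  rw [Finsupp.linearCombination_apply, Finsupp.sum, Finset.sum_apply, sum_eq_single ν] at h1
  · rw [Pi.smul_apply, smul_eq_mul] at h1
    exact mul_ne_zero (Finsupp.mem_support_iff.1 hν) (fsFun_self_ne_zero ν) h1
  · intro μ hμ hne
    rw [Pi.smul_apply, fsFun_of_card_le (hmin μ hμ) hne, smul_zero]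
  · exact fun h2 => absurd hν h2

theorem linearIndependent_fsFun [CharZero 𝕜] : LinearIndependent 𝕜 (fsFun 𝕜) := by
  rw [linearIndependent_iff]
  intro a ha
  exact eq_zero_of_linearCombination_fsFun a fun ν _ => by rw [ha]; rfl

theorem eq_zero_of_mem_fsSpan [CharZero 𝕜] {m : ℕ} {b : YoungDiagram → 𝕜} (hb : b ∈ fsSpan 𝕜 m)
    (h : ∀ ν : YoungDiagram, ν.card ≤ m → b ν = 0) : b = 0 := by
  obtain ⟨a, ha, rfl⟩ := (Finsupp.mem_span_image_iff_linearCombination 𝕜).1 hb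
  rw [eq_zero_of_linearCombination_fsFun a fun ν hν =>
    h ν ((Finsupp.mem_supported 𝕜 a).1 ha hν), map_zero]

theorem alt_comp_perm {N : ℕ} (e : Fin N → ℕ) (σ : Equiv.Perm (Fin N)) (l : Fin N → ℕ) :
    alt 𝕜 (e ∘ σ) l = ((Equiv.Perm.sign σ : ℤ) : 𝕜) * alt 𝕜 e l := by
  rw [alt, alt, ← Matrix.det_permute']
  rfl

/-- An alternant with a repeated exponent is zero. Otherwise sorting its exponents, at the cost of a
sign, gives `beta N μ` for some μ; the bound on the total exponent becomes |μ| ≤ m by `sum_beta`,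
and `fsFun_mul_alt` concludes. -/
theorem exists_fsSpan_of_mem_altSpan [CharZero 𝕜] {N m : ℕ} {F : (Fin N → ℕ) → 𝕜}
    (hF : F ∈ altSpan 𝕜 N ((∑ r : Fin N, (N - 1 - r)) + m)) :
    ∃ b ∈ fsSpan 𝕜 m, ∀ ν : YoungDiagram, ν.rowLen N = 0 →
      F (beta N ν) = b ν * alt 𝕜 (beta N ⊥) (beta N ν) := by
  induction hF using Submodule.span_induction with
  | mem F hF =>
    obtain ⟨e, he, rfl⟩ := hF
    by_cases hinj : Function.Injective e
    · obtain ⟨σ, hσ⟩ := exists_perm_strictAnti hinj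
      obtain ⟨μ, hμ, hβ⟩ := exists_beta_eq hσ
      have hcard : μ.card ≤ m := by
        have h1 := sum_beta hμ
        have h2 : ∑ i, (e ∘ σ) i = ∑ i, e i := Equiv.sum_comp σ e
        rw [hβ] at h1
        omega
      refine ⟨((Equiv.Perm.sign σ : ℤ) : 𝕜) • fsFun 𝕜 μ,
        Submodule.smul_mem _ _ (Submodule.subset_span ⟨μ, hcard, rfl⟩), fun ν hν => ?_⟩
      rw [Pi.smul_apply, smul_eq_mul, mul_assoc, fsFun_mul_alt 𝕜 hμ hν, hβ, alt_comp_perm,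
        ← mul_assoc, ← Int.cast_mul, ← Units.val_mul, Int.units_mul_self, Units.val_one,
        Int.cast_one, one_mul]
    · obtain ⟨i, j, hij, hne⟩ : ∃ i j, e i = e j ∧ i ≠ j := by
        simpa [Function.Injective] using hinj
      refine ⟨0, Submodule.zero_mem _, fun ν _ => ?_⟩
      rw [alt, Matrix.det_zero_of_column_eq hne (fun r => by simp [hij])]
      simp
  | zero => exact ⟨0, Submodule.zero_mem _, fun ν _ => by simp⟩
  | add u v _ _ hu hv =>
    obtain ⟨b, hb, hb'⟩ := hu
    obtain ⟨c, hc, hc'⟩ := hv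
    refine ⟨b + c, Submodule.add_mem _ hb hc, fun ν hν => ?_⟩
    rw [Pi.add_apply, Pi.add_apply, hb' ν hν, hc' ν hν, add_mul]
  | smul x u _ hu =>
    obtain ⟨b, hb, hb'⟩ := hu
    refine ⟨x • b, Submodule.smul_mem _ x hb, fun ν hν => ?_⟩
    rw [Pi.smul_apply, Pi.smul_apply, hb' ν hν, smul_eq_mul, smul_eq_mul, mul_assoc]

theorem exists_fsSpan_toFun_monomial [CharZero 𝕜] (N : ℕ) {m : ℕ} {s : ℕ+ →₀ ℕ} (hs : wt s ≤ m) :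
    ∃ b ∈ fsSpan 𝕜 m, ∀ ν : YoungDiagram, ν.rowLen N = 0 →
      toFun 𝕜 (MvPolynomial.monomial s 1) ν = b ν := by
  have h0 : alt 𝕜 (beta N ⊥) ∈ altSpan 𝕜 N (∑ r : Fin N, (N - 1 - r)) :=
    alt_mem_altSpan (by rw [sum_beta (card_bot_rowLen N), card_bot, zero_add])
  have h1 := monomial_mul_mem_altSpan ((N : 𝕜) - 1 / 2)
    (fun k => ∑ r ∈ range N, (-(r : 𝕜) - 1 / 2) ^ (k : ℕ)) s h0
  obtain ⟨b, hb, hb'⟩ := exists_fsSpan_of_mem_altSpan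
    (altSpan_mono N (Nat.add_le_add_left hs _) h1)
  refine ⟨b, hb, fun ν hν => ?_⟩
  refine mul_right_cancel₀ (alt_bot_ne_zero 𝕜 hν) ?_
  rw [← hb' ν hν, toFun_apply, MvPolynomial.eval_monomial, one_mul]
  congr 2
  funext k n
  rw [toFun_psum_eq_sum_beta k hν]

/-- The combinations obtained for different N must be shown to agree. An element of `fsSpan 𝕜 m` is
determined by its values on diagrams with at most m boxes, and these have at most m rows, so N = m
already fixes it. -/
theorem toFun_monomial_mem_fsSpan [CharZero 𝕜] {m : ℕ} {s : ℕ+ →₀ ℕ} (hs : wt s ≤ m) :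
    toFun 𝕜 (MvPolynomial.monomial s 1) ∈ fsSpan 𝕜 m := by
  obtain ⟨b, hb, hb'⟩ := exists_fsSpan_toFun_monomial (𝕜 := 𝕜) m hs
  convert! hb using 1
  funext ν
  obtain ⟨c, hc, hc'⟩ := exists_fsSpan_toFun_monomial (𝕜 := 𝕜) (max m ν.card) hs
  rw [hc' ν (rowLen_eq_zero_of_card_le (le_max_right _ _))]
  have : c - b = 0 := eq_zero_of_mem_fsSpan (Submodule.sub_mem _ hc hb) fun κ hκ => by
    rw [Pi.sub_apply, ← hb' κ (rowLen_eq_zero_of_card_le hκ),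
      ← hc' κ (rowLen_eq_zero_of_card_le (hκ.trans (le_max_left _ _))), sub_self]
  rw [sub_eq_zero.1 this]

end

section

/-! ### Dimension count -/

theorem finite_setOf_card_le (m : ℕ) : {μ : YoungDiagram | μ.card ≤ m}.Finite := by
  refine Set.Finite.subset ((range (m + 1)).finite_toSet.biUnion
    (fun n _ => Set.finite_range (fun ν : Level n => ν.1))) ?_
  intro μ hμ
  simp only [Set.mem_iUnion]
  exact ⟨μ.card, mem_coe.2 (mem_range.2 (Nat.lt_succ_of_le hμ)), ⟨⟨μ, rfl⟩, rfl⟩⟩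

/-- The number of columns of each height, as an exponent vector. -/
noncomputable def colMultiplicity (μ : YoungDiagram) : ℕ+ →₀ ℕ :=
  Finsupp.onFinset ((range μ.card).image Nat.succPNat)
    (fun k => μ.rowLen (k - 1) - μ.rowLen k) (by
      intro k hk
      rw [mem_image]
      refine ⟨k - 1, mem_range.2 ?_, ?_⟩
      · by_contra h
        rw [rowLen_eq_zero_of_card_le (not_lt.1 h)] at hk
        simp at hk
      · rw [← PNat.natPred, PNat.succPNat_natPred])

theorem colMultiplicity_succPNat (μ : YoungDiagram) (r : ℕ) :
    colMultiplicity μ r.succPNat = μ.rowLen r - μ.rowLen (r + 1) := by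
  rw [colMultiplicity, Finsupp.onFinset_apply, Nat.succPNat_coe, Nat.succ_sub_one]

theorem sum_mul_rowLen_sub (μ : YoungDiagram) (N : ℕ) :
    ∑ r ∈ range N, (μ.rowLen r - μ.rowLen (r + 1)) * (r + 1) + N * μ.rowLen N =
      ∑ r ∈ range N, μ.rowLen r := by
  induction N with
  | zero => simp
  | succ N ih =>
    rw [sum_range_succ, sum_range_succ, ← ih]
    have h := μ.rowLen_anti N (N + 1) (Nat.le_succ N)
    obtain ⟨d, hd⟩ := Nat.exists_eq_add_of_le h
    rw [hd, Nat.add_sub_cancel_left]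
    ring

theorem wt_colMultiplicity (μ : YoungDiagram) : wt (colMultiplicity μ) = μ.card := by
  have hN : μ.rowLen μ.card = 0 := rowLen_eq_zero_of_card_le le_rfl
  rw [wt, Finsupp.weight_apply, Finsupp.sum_of_support_subset (s := (range μ.card).image Nat.succPNat)
    _ (show (colMultiplicity μ).support ⊆ _ from Finsupp.support_onFinset_subset) _ (by simp),
    sum_image (fun a _ b _ h => Nat.succPNat_injective h)]
  have h := sum_mul_rowLen_sub μ μ.card
  rw [hN, mul_zero, add_zero, ← card_eq_sum_rowLen hN] at h
  refine Eq.trans (sum_congr rfl fun r _ => ?_) h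
  rw [colMultiplicity_succPNat, Nat.succPNat_coe, smul_eq_mul]

theorem colMultiplicity_injective : Function.Injective colMultiplicity := by
  intro κ ν h
  have hdiff : ∀ r, κ.rowLen r - κ.rowLen (r + 1) = ν.rowLen r - ν.rowLen (r + 1) := fun r => by
    rw [← colMultiplicity_succPNat, h, colMultiplicity_succPNat]
  set N := max κ.card ν.card with hN
  have key : ∀ d r, r + d = N → κ.rowLen r = ν.rowLen r := by
    intro d
    induction d with
    | zero =>
      intro r hr
      rw [rowLen_eq_zero_of_card_le (by omega), rowLen_eq_zero_of_card_le (by omega)]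
    | succ d ih =>
      intro r hr
      have h1 := ih (r + 1) (by omega)
      have h2 := hdiff r
      have h3 := κ.rowLen_anti r (r + 1) (Nat.le_succ r)
      have h4 := ν.rowLen_anti r (r + 1) (Nat.le_succ r)
      omega
  refine ext_rowLen fun i => ?_
  by_cases hi : i ≤ N
  · exact key (N - i) i (by omega)
  · rw [rowLen_eq_zero_of_card_le (by omega), rowLen_eq_zero_of_card_le (by omega)]

variable (𝕜 : Type*) [Field 𝕜] [Algebra 𝕜 ℂ]

/-- The inclusion comes from `toFun_monomial_mem_fsSpan`. For equality dimensions are compared: the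
left side has the monomials of weight at most m as a basis, the right side is spanned by the
diagrams of size at most m, and `colMultiplicity` embeds these diagrams in those monomials. -/
theorem map_toFun_restrictSupport (m : ℕ) :
    (MvPolynomial.restrictSupport 𝕜 {s : ℕ+ →₀ ℕ | wt s ≤ m}).map (toFun 𝕜).toLinearMap =
      fsSpan 𝕜 m := by
  have := charZero_of_algebra_complex 𝕜
  have hinj : Function.Injective (toFun 𝕜).toLinearMap := toFun_injective 𝕜
  have hle : (MvPolynomial.restrictSupport 𝕜 {s : ℕ+ →₀ ℕ | wt s ≤ m}).map (toFun 𝕜).toLinearMap ≤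
      fsSpan 𝕜 m := by
    rw [MvPolynomial.restrictSupport_eq_span, Submodule.map_span, Submodule.span_le]
    rintro _ ⟨_, ⟨s, hs, rfl⟩, rfl⟩
    exact toFun_monomial_mem_fsSpan hs
  have hfinY : Finite {μ : YoungDiagram | μ.card ≤ m} := finite_setOf_card_le m
  have hfin : FiniteDimensional 𝕜 (fsSpan 𝕜 m) :=
    FiniteDimensional.span_of_finite 𝕜 ((finite_setOf_card_le m).image _)
  refine Submodule.eq_of_le_of_finrank_le hle ?_
  have hfin2 : FiniteDimensional 𝕜
      ((MvPolynomial.restrictSupport 𝕜 {s : ℕ+ →₀ ℕ | wt s ≤ m}).map (toFun 𝕜).toLinearMap) :=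
    Submodule.finiteDimensional_of_le hle
  let e := Submodule.equivMapOfInjective (toFun 𝕜).toLinearMap hinj
    (MvPolynomial.restrictSupport 𝕜 {s : ℕ+ →₀ ℕ | wt s ≤ m})
  let B := (MvPolynomial.basisRestrictSupport 𝕜 {s : ℕ+ →₀ ℕ | wt s ≤ m}).map e
  -- The index set is finite because it labels a basis of a finite-dimensional space.
  have hfinS : Finite {s : ℕ+ →₀ ℕ | wt s ≤ m} := Module.Finite.finite_basis B
  rw [Module.finrank_eq_nat_card_basis B]
  have h1 : Module.finrank 𝕜 (fsSpan 𝕜 m) ≤ Nat.card {μ : YoungDiagram | μ.card ≤ m} := by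
    have : Fintype {μ : YoungDiagram | μ.card ≤ m} := Fintype.ofFinite _
    have h := finrank_range_le_card (R := 𝕜)
      (fun μ : {μ : YoungDiagram | μ.card ≤ m} => fsFun 𝕜 μ.1)
    rw [← Nat.card_eq_fintype_card] at h
    rw [fsSpan, Set.image_eq_range]
    exact h
  refine h1.trans (Nat.card_le_card_of_injective
    (fun μ : {μ : YoungDiagram | μ.card ≤ m} =>
      (⟨colMultiplicity μ.1, (wt_colMultiplicity μ.1).le.trans μ.2⟩ :
        {s : ℕ+ →₀ ℕ | wt s ≤ m})) fun a b hab => ?_)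
  exact Subtype.ext (colMultiplicity_injective (Subtype.ext_iff.1 hab))

/-! ### The Frobenius–Schur basis -/

theorem toFun_FS (μ : YoungDiagram) : toFun 𝕜 (FS 𝕜 μ) = fsFun 𝕜 μ := by
  have h : fsFun 𝕜 μ ∈ fsSpan 𝕜 μ.card :=
    Submodule.subset_span ⟨μ, le_refl μ.card, rfl⟩
  rw [← map_toFun_restrictSupport] at h
  obtain ⟨f, -, hf⟩ := h
  exact Function.invFun_eq ⟨f, hf⟩

theorem linearIndependent_FS : LinearIndependent 𝕜 (FS 𝕜) := by
  have := charZero_of_algebra_complex 𝕜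
  refine LinearIndependent.of_comp (toFun 𝕜).toLinearMap ?_
  convert! linearIndependent_fsFun (𝕜 := 𝕜) using 1
  funext μ
  exact toFun_FS 𝕜 μ

theorem span_FS : Submodule.span 𝕜 (Set.range (FS 𝕜)) = ⊤ := by
  have := charZero_of_algebra_complex 𝕜
  rw [eq_top_iff]
  intro f _
  have hrange : ∀ m, fsSpan 𝕜 m ≤
      (Submodule.span 𝕜 (Set.range (FS 𝕜))).map (toFun 𝕜).toLinearMap := by
    intro m
    rw [fsSpan, Submodule.span_le]
    rintro _ ⟨μ, -, rfl⟩
    exact ⟨FS 𝕜 μ, Submodule.subset_span ⟨μ, rfl⟩, toFun_FS 𝕜 μ⟩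
  have hmem : toFun 𝕜 f ∈ (Submodule.span 𝕜 (Set.range (FS 𝕜))).map (toFun 𝕜).toLinearMap := by
    refine hrange (f.support.sup wt) ?_
    rw [← map_toFun_restrictSupport]
    refine ⟨f, ?_, rfl⟩
    rw [SetLike.mem_coe, MvPolynomial.mem_restrictSupport_iff]
    intro s hs
    exact le_sup (f := wt) hs
  obtain ⟨g, hg, hgf⟩ := hmem
  rwa [toFun_injective 𝕜 hgf] at hg

/-- The Frobenius–Schur functions as a basis of `Λ`. -/
noncomputable def basisFS : Module.Basis YoungDiagram 𝕜 (Sym 𝕜) :=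
  Module.Basis.mk (linearIndependent_FS 𝕜) (span_FS 𝕜).ge

theorem basisFS_apply (μ : YoungDiagram) : basisFS 𝕜 μ = FS 𝕜 μ := by
  rw [basisFS, Module.Basis.mk_apply]

/-! ### The operators on symmetric functions -/

/-- The operator `FS_μ ↦ (p_1 - |μ|) FS_μ`. -/
noncomputable def downSym : Sym 𝕜 →ₗ[𝕜] Sym 𝕜 :=
  (basisFS 𝕜).constr 𝕜 (fun μ => (psum 𝕜 1 - MvPolynomial.C (μ.card : 𝕜)) * FS 𝕜 μ)

theorem downSym_FS (μ : YoungDiagram) :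
    downSym 𝕜 (FS 𝕜 μ) = (psum 𝕜 1 - MvPolynomial.C (μ.card : 𝕜)) * FS 𝕜 μ := by
  rw [downSym, ← basisFS_apply, Module.Basis.constr_basis, basisFS_apply]

theorem implementsDown_downSym : ImplementsDown (downSym 𝕜) := by
  have := charZero_of_algebra_complex 𝕜
  intro n f
  funext ν
  have h : ∀ f ∈ Submodule.span 𝕜 (Set.range (FS 𝕜)), downOp n (restrict n f) ν =
      ((1 / ((n : 𝕜) + 1)) • restrict (n + 1) (downSym 𝕜 f)) ν := by
    intro f hf
    induction hf using Submodule.span_induction with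
    | mem f hf =>
      obtain ⟨μ, rfl⟩ := hf
      have h1 : restrict n (FS 𝕜 μ) = fun κ : Level n => fsFun 𝕜 μ κ.1 := by
        funext κ
        rw [restrict, toFun_FS]
      rw [h1, downOp_fsFun, downSym_FS, Pi.smul_apply, smul_eq_mul, restrict, map_mul, map_sub,
        Pi.mul_apply, Pi.sub_apply, toFun_FS, toFun_C, toFun_psum_one]
    | zero => simp [downOp, restrict]
    | add f g _ _ hf hg =>
      have h1 : downOp n (restrict n (f + g)) ν =
          downOp n (restrict n f) ν + downOp n (restrict n g) ν := by
        simp only [downOp, restrict, map_add, Pi.add_apply, mul_add, sum_add_distrib]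
      rw [h1, hf, hg]
      simp only [Pi.smul_apply, restrict, map_add, Pi.add_apply, smul_eq_mul, mul_add]
    | smul c f _ hf =>
      have h1 : downOp n (restrict n (c • f)) ν = c * downOp n (restrict n f) ν := by
        simp only [downOp, restrict, map_smul, Pi.smul_apply, smul_eq_mul, mul_sum]
        exact sum_congr rfl fun _ _ => by ring
      rw [h1, hf]
      simp only [Pi.smul_apply, restrict, map_smul, smul_eq_mul]
      ring
  exact h f (by rw [span_FS]; trivial)

/-- The relation fixes D f only on nonempty diagrams. As p_1 vanishes at ∅, it makes p_1 · D f and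
p_1 · D' f agree everywhere, and p_1 cancels in the domain `Λ`. -/
theorem implementsDown_unique {D D' : Sym 𝕜 →ₗ[𝕜] Sym 𝕜} (h : ImplementsDown D)
    (h' : ImplementsDown D') : D = D' := by
  have := charZero_of_algebra_complex 𝕜
  refine LinearMap.ext fun f => ?_
  have hX : psum 𝕜 1 ≠ 0 := MvPolynomial.X_ne_zero _
  refine mul_left_cancel₀ hX (toFun_injective 𝕜 (funext fun ν => ?_))
  rw [map_mul, map_mul, Pi.mul_apply, Pi.mul_apply, toFun_psum_one]
  rcases hn : ν.card with _ | n
  · simp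
  · have h1 := congrFun ((h n f).symm.trans (h' n f)) ⟨ν, hn⟩
    rw [Pi.smul_apply, Pi.smul_apply, smul_eq_mul, smul_eq_mul] at h1
    have hn1 : (1 / ((n : 𝕜) + 1)) ≠ 0 :=
      one_div_ne_zero (by exact_mod_cast Nat.succ_ne_zero n)
    have h2 : toFun 𝕜 (D f) ν = toFun 𝕜 (D' f) ν := mul_left_cancel₀ hn1 h1
    rw [h2]

/-- Each box of content c contributes (z+c)(z'+c) = zz' + c(z+z') + c², which involves z and z' only
through their sum and product. -/
theorem exists_algebraMap_eq_weight {z z' : ℂ} (hadd : z + z' ∈ Set.range (algebraMap 𝕜 ℂ))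
    (hmul : z * z' ∈ Set.range (algebraMap 𝕜 ℂ)) (ν κ : YoungDiagram) :
    ∃ a : 𝕜, algebraMap 𝕜 ℂ a = weight z z' ν κ := by
  obtain ⟨s, hs⟩ := hadd
  obtain ⟨p, hp⟩ := hmul
  refine ⟨∏ c ∈ ν.cells \ κ.cells,
    (p + ((c.2 : 𝕜) - (c.1 : 𝕜)) * s + ((c.2 : 𝕜) - (c.1 : 𝕜)) ^ 2), ?_⟩
  rw [weight, poch, poch, ← prod_mul_distrib, map_prod]
  refine prod_congr rfl fun c _ => ?_
  simp only [map_add, map_mul, map_sub, map_pow, map_natCast, hs, hp]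
  ring

theorem algebraMap_fsFun (μ ν : YoungDiagram) :
    algebraMap 𝕜 ℂ (fsFun 𝕜 μ ν) = fsFun ℂ μ ν := by
  simp [fsFun]

theorem toFun_complexify_FS (μ ν : YoungDiagram) :
    toFun ℂ (complexify (FS 𝕜 μ)) ν = fsFun ℂ μ ν := by
  rw [toFun_complexify, toFun_FS, algebraMap_fsFun]

variable {𝕜}

/-- The coefficients are chosen in 𝕜 as preimages of the weights. The formula is stated after
`complexify`, where the weights and zz' can be written directly as complex numbers. -/
theorem exists_implementsUp {z z' : ℂ} (hadd : z + z' ∈ Set.range (algebraMap 𝕜 ℂ))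
    (hmul : z * z' ∈ Set.range (algebraMap 𝕜 ℂ)) :
    ∃ U : Sym 𝕜 →ₗ[𝕜] Sym 𝕜, ImplementsUp z z' U ∧ ∀ μ, complexify (U (FS 𝕜 μ)) =
      ∑ κ ∈ lower μ, MvPolynomial.C (poch z μ κ * poch z' μ κ) * complexify (FS 𝕜 κ) +
        (psum ℂ 1 + MvPolynomial.C (z * z' + (μ.card : ℂ))) * complexify (FS 𝕜 μ) := by
  choose w hw using exists_algebraMap_eq_weight 𝕜 hadd hmul
  obtain ⟨p, hp⟩ := hmul
  let U : Sym 𝕜 →ₗ[𝕜] Sym 𝕜 := (basisFS 𝕜).constr 𝕜 (fun μ =>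
    ∑ κ ∈ lower μ, MvPolynomial.C (w μ κ) * FS 𝕜 κ +
      (psum 𝕜 1 + MvPolynomial.C (p + (μ.card : 𝕜))) * FS 𝕜 μ)
  have hU : ∀ μ, complexify (U (FS 𝕜 μ)) =
      ∑ κ ∈ lower μ, MvPolynomial.C (poch z μ κ * poch z' μ κ) * complexify (FS 𝕜 κ) +
        (psum ℂ 1 + MvPolynomial.C (z * z' + (μ.card : ℂ))) * complexify (FS 𝕜 μ) := by
    intro μ
    have h1 : U (FS 𝕜 μ) = ∑ κ ∈ lower μ, MvPolynomial.C (w μ κ) * FS 𝕜 κ +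
        (psum 𝕜 1 + MvPolynomial.C (p + (μ.card : 𝕜))) * FS 𝕜 μ := by
      rw [← basisFS_apply, Module.Basis.constr_basis, basisFS_apply]
    have hC : ∀ a : 𝕜, complexify (MvPolynomial.C a) = MvPolynomial.C (algebraMap 𝕜 ℂ a) :=
      fun a => MvPolynomial.map_C _ a
    have hX : complexify (psum 𝕜 1) = psum ℂ 1 := MvPolynomial.map_X _ _
    rw [h1, map_add, map_sum, map_mul, map_add, hC, hX, map_add, hp, map_natCast]
    congr 1
    refine sum_congr rfl fun κ _ => ?_
    rw [map_mul, hC, hw]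
    rfl
  refine ⟨U, fun n f => ?_, hU⟩
  funext ν
  have h : ∀ f ∈ Submodule.span 𝕜 (Set.range (FS 𝕜)),
      upOp z z' n (fun ρ => algebraMap 𝕜 ℂ (restrict (n + 1) f ρ)) ν =
      1 / (z * z' + (n : ℂ)) * algebraMap 𝕜 ℂ (restrict n (U f) ν) := by
    intro f hf
    induction hf using Submodule.span_induction with
    | mem f hf =>
      obtain ⟨μ, rfl⟩ := hf
      have h1 : (fun ρ => algebraMap 𝕜 ℂ (restrict (n + 1) (FS 𝕜 μ) ρ)) =
          fun ρ : Level (n + 1) => fsFun ℂ μ ρ.1 := by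
        funext ρ
        rw [restrict, toFun_FS, algebraMap_fsFun]
      rw [h1, upOp_fsFun, restrict, ← toFun_complexify, hU, map_add, map_sum, map_mul, map_add,
        Pi.add_apply, Pi.mul_apply, Pi.add_apply, toFun_C, toFun_psum_one, toFun_complexify_FS,
        Finset.sum_apply]
      congr 2
      · refine sum_congr rfl fun κ _ => ?_
        rw [map_mul, Pi.mul_apply, toFun_C, toFun_complexify_FS, weight]
      · ring
    | zero => simp [upOp, restrict]
    | add f g _ _ hf hg =>
      have h1 : upOp z z' n (fun ρ => algebraMap 𝕜 ℂ (restrict (n + 1) (f + g) ρ)) ν =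
          upOp z z' n (fun ρ => algebraMap 𝕜 ℂ (restrict (n + 1) f ρ)) ν +
            upOp z z' n (fun ρ => algebraMap 𝕜 ℂ (restrict (n + 1) g ρ)) ν := by
        simp only [upOp, restrict, map_add, Pi.add_apply, mul_add, sum_add_distrib]
      rw [h1, hf, hg]
      simp only [restrict, map_add, Pi.add_apply, mul_add]
    | smul c f _ hf =>
      have h1 : upOp z z' n (fun ρ => algebraMap 𝕜 ℂ (restrict (n + 1) (c • f) ρ)) ν =
          algebraMap 𝕜 ℂ c * upOp z z' n (fun ρ => algebraMap 𝕜 ℂ (restrict (n + 1) f ρ)) ν := by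
        simp only [upOp, restrict, map_smul, Pi.smul_apply, smul_eq_mul, map_mul, mul_sum]
        exact sum_congr rfl fun _ _ => by ring
      rw [h1, hf]
      simp only [restrict, map_smul, Pi.smul_apply, smul_eq_mul, map_mul]
      ring
  exact h f (by rw [span_FS]; trivial)

theorem implementsUp_unique {z z' : ℂ} (hz : ∀ k : ℕ, z * z' ≠ -(k : ℂ))
    {U U' : Sym 𝕜 →ₗ[𝕜] Sym 𝕜} (h : ImplementsUp z z' U) (h' : ImplementsUp z z' U') :
    U = U' := by
  refine LinearMap.ext fun f => toFun_injective 𝕜 (funext fun ν => ?_)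
  have h1 := congrFun ((h ν.card f).symm.trans (h' ν.card f)) ⟨ν, rfl⟩
  rw [Pi.smul_apply, Pi.smul_apply, smul_eq_mul, smul_eq_mul] at h1
  have hn : 1 / (z * z' + (ν.card : ℂ)) ≠ 0 :=
    one_div_ne_zero fun h0 => hz ν.card (eq_neg_of_add_eq_zero_left h0)
  exact (algebraMap 𝕜 ℂ).injective (mul_left_cancel₀ hn h1)

end

end YoungUpDown

theorem theorem4p1 {𝕜 : Type*} [Field 𝕜] [Algebra 𝕜 ℂ] :
    -- the Frobenius–Schur functions are well defined and form a basis of `Λ`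
    (Function.Injective (YoungUpDown.toFun 𝕜) ∧
      (∀ μ ν : YoungDiagram,
        YoungUpDown.toFun 𝕜 (YoungUpDown.FS 𝕜 μ) ν = YoungUpDown.fsFun 𝕜 μ ν) ∧
      LinearIndependent 𝕜 (YoungUpDown.FS 𝕜) ∧
      Submodule.span 𝕜 (Set.range (YoungUpDown.FS 𝕜)) = ⊤) ∧
    -- the down operator
    ((∃! D : YoungUpDown.Sym 𝕜 →ₗ[𝕜] YoungUpDown.Sym 𝕜, YoungUpDown.ImplementsDown D) ∧
      (∀ D : YoungUpDown.Sym 𝕜 →ₗ[𝕜] YoungUpDown.Sym 𝕜, YoungUpDown.ImplementsDown D →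
        ∀ μ : YoungDiagram,
          D (YoungUpDown.FS 𝕜 μ) =
            (YoungUpDown.psum 𝕜 1 - MvPolynomial.C (μ.card : 𝕜)) * YoungUpDown.FS 𝕜 μ)) ∧
    -- the up operator
    (∀ z z' : ℂ, (∀ k : ℕ, z * z' ≠ -(k : ℂ)) →
      z + z' ∈ Set.range (algebraMap 𝕜 ℂ) → z * z' ∈ Set.range (algebraMap 𝕜 ℂ) →
      (∃! U : YoungUpDown.Sym 𝕜 →ₗ[𝕜] YoungUpDown.Sym 𝕜, YoungUpDown.ImplementsUp z z' U) ∧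
      (∀ U : YoungUpDown.Sym 𝕜 →ₗ[𝕜] YoungUpDown.Sym 𝕜, YoungUpDown.ImplementsUp z z' U →
        ∀ μ : YoungDiagram,
          YoungUpDown.complexify (U (YoungUpDown.FS 𝕜 μ)) =
            ∑ κ ∈ YoungUpDown.lower μ,
              MvPolynomial.C (YoungUpDown.poch z μ κ * YoungUpDown.poch z' μ κ) *
                YoungUpDown.complexify (YoungUpDown.FS 𝕜 κ) +
            (YoungUpDown.psum ℂ 1 + MvPolynomial.C (z * z' + (μ.card : ℂ))) *
              YoungUpDown.complexify (YoungUpDown.FS 𝕜 μ))) := by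
  refine ⟨⟨YoungUpDown.toFun_injective 𝕜, fun μ ν => by rw [YoungUpDown.toFun_FS],
    YoungUpDown.linearIndependent_FS 𝕜, YoungUpDown.span_FS 𝕜⟩, ⟨?_, ?_⟩, ?_⟩
  · exact ⟨YoungUpDown.downSym 𝕜, YoungUpDown.implementsDown_downSym 𝕜,
      fun D hD => YoungUpDown.implementsDown_unique 𝕜 hD (YoungUpDown.implementsDown_downSym 𝕜)⟩
  · intro D hD μ
    rw [YoungUpDown.implementsDown_unique 𝕜 hD (YoungUpDown.implementsDown_downSym 𝕜),
      YoungUpDown.downSym_FS]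
  · intro z z' hz hadd hmul
    obtain ⟨U, hU, hFS⟩ := YoungUpDown.exists_implementsUp hadd hmul
    refine ⟨⟨U, hU, fun V hV => YoungUpDown.implementsUp_unique hz hV hU⟩, fun V hV μ => ?_⟩
    rw [YoungUpDown.implementsUp_unique hz hV hU, hFS]
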